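/- **Theorem (Regret of CLCB-SC-LS).** *Model.* Let $\mathcal Q$ be a set of $m$ queries with arrival probabilities $p(q)>0$, $\sum_q p(q)=1$, expected serving costs $c(q)\in(0,1]$, and a distance $d:\mathcal Q\times\mathcal Q\to[0,\infty)$ with $d(q,q)=0$ (no further property of $d$ is needed). For $\mathcal M\subseteq\mathcal Q$ put $d(q,\mathcal M)=\min_{u\in\mathcal M}d(q,u)$, $d(q,\emptyset)=\infty$, and $$\ell(\mathcal M;p,c,d)=\sum_{q\in\mathcal Q}p(q)\min\{c(q),d(q,\mathcal M)\};$$ let $\mathcal M^*$ minimize $\ell(\cdot;p,c,d)$ over all $\mathcal M$ with $|\mathcal M|\le k$. Let $$\kappa=1-\min_{q}\frac{\ell(\mathcal Q\setminus\{q\})-\ell(\mathcal Q)}{\ell(\emptyset)-\ell(\{q\})}$$ be the curvature of $\ell(\cdot;p,c,d)$; assume $\kappa<1$ and let $\alpha=(e^\beta-1)/\beta$ with $\beta=\kappa/(1-\kappa)$ ($\alpha=1$ if $\beta=0$). In the rounds $t=1,\dots,T$ independent queries $q_t\sim p$ arrive. Calling the LLM for $q$ in round $t$ has the random cost $C_t(q)=c(q)+\epsilon_t(q)$,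 where $\epsilon_t(q)$ is zero-mean sub-Gaussian with variance proxy $1/4$; the pairs $(q_t,C_t)$ are independent over $t$, and $q_t$ is independent of $C_t$. *Oracle.* $\mathtt{Reverse\_Greedy}(p',c')$ starts with $\mathcal M=\mathcal Q$ and, $m-k$ times, removes from $\mathcal M$ some $q\in\mathcal M$ that minimizes $\ell(\mathcal M\setminus\{q\};p',c',d)$ (ties are broken by any fixed measurable rule). *Algorithm CLCB-SC-LS* ($m,k,T,d$ known, $p,c$ unknown). Let $\mathcal M_0=\emptyset$. For each $q$ let $N_p(q)$ be the number of past arrivals of $q$, $N_c(q)$ the number of past observed costs of $q$ and $L_c(q)$ their sum. The observations of each $q$, and likewise all arrivals, are divided into consecutive stages, the first of which begins before round 1; for the current stage let $n_q$ (resp. $n_p$) be the number of observations of $q$ (resp. of arrivals) in it, and $s_q$ (resp. $s_p$) their number in all earlier stages. At the beginning of round $t$: if some $q$ has $n_q\ge 1+\sqrt{T s_q/m}$, begin a new stage for it and switch the cache; otherwise, if $n_p\ge 1+\sqrt{T s_p}$, begin a new stage of arrivals and switch the cache; otherwise let $\mathcal M_t=\mathcal M_{t-1}$. To switch the cache, set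 $\hat p(q)=N_p(q)/t$ and $\underline c(q)=L_c(q)/N_c(q)-\sqrt{\log(4mT^3)/(2N_c(q))}$ for all $q$ ($\underline c(q)=-\infty$ if $N_c(q)=0$), and let $\mathcal M_t=\mathtt{Reverse\_Greedy}(\hat p,\underline c)$; the values $\underline c$ are kept until the next switch, and are $-\infty$ before the first. Then, if $\underline c(q_t)<d(q_t,\mathcal M_t)$, call the LLM and observe $C_t(q_t)$; otherwise serve $q_t$ from the cache without an observation. *Regret.* The $\alpha$-approximate regret with switching cost is $$\mathrm{Reg}(T)=\mathbb E\Big[\sum_{t=1}^T\Big(\ell(\mathcal M_t;p,c,d)+\sum_{q\in\mathcal M_t\setminus\mathcal M_{t-1}}c(q)\Big)\Big]-\sum_{t=1}^T\alpha\,\ell(\mathcal M^*;p,c,d).$$ *Claim.* For every $A$ there is a constant $C>0$, depending only on $A$, such that for all $m$, $k$, $T\ge3$, $p$, $c$, $d$ with $\alpha\le A$, all noise distributions and all tie-breaking rules as above, the expectation in $\mathrm{Reg}(T)$ exists and $$\mathrm{Reg}(T)\le C\big(\sqrt{mT\log(mT)}+m^2\big)\log\log T ;$$ and if $T\ge m^3$,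 so that the term $m^2\log\log T$ for the refilling of the cache is of lower order, then $$\mathrm{Reg}(T)\le C\,\sqrt{mT\log(mT)}\,\log\log T .$$ -/

import Mathlib

open MeasureTheory ProbabilityTheory

noncomputable section

namespace SemanticCaching

variable {m : ℕ}

/-- `d(q, M) = min_{u ∈ M} d(q, u)`, with the value `+∞` for the empty cache. -/
def distTo (d : Fin m → Fin m → ℝ) (q : Fin m) (M : Finset (Fin m)) : WithTop ℝ :=
  M.inf fun u => (d q u : WithTop ℝ)

/-- `min {x, d(q, M)}`; the minimum with the real number `x` is never `+∞`, so the default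
value `0` is never used. -/
def serveLoss (x : ℝ) (d : Fin m → Fin m → ℝ) (q : Fin m) (M : Finset (Fin m)) : ℝ :=
  (min (x : WithTop ℝ) (distTo d q M)).untopD 0

/-- The expected loss `ℓ(M; p, c, d) = ∑_q p(q) min {c(q), d(q, M)}`. -/
def loss (p c : Fin m → ℝ) (d : Fin m → Fin m → ℝ) (M : Finset (Fin m)) : ℝ :=
  ∑ q, p q * serveLoss (c q) d q M

/-- `ℓ(M*; p, c, d)`, the smallest loss of a cache with at most `k` elements. -/
def optLoss (k : ℕ) (p c : Fin m → ℝ) (d : Fin m → Fin m → ℝ) : ℝ :=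
  (Finset.univ.filter fun M : Finset (Fin m) => M.card ≤ k).inf' ⟨∅, by simp⟩ (loss p c d)

/-- The curvature
`1 - min_q (ℓ(Q \ {q}) - ℓ(Q)) / (ℓ(∅) - ℓ({q}))` of the loss. -/
def curvature (p c : Fin m → ℝ) (d : Fin m → Fin m → ℝ) : ℝ :=
  1 - ⨅ q : Fin m,
    (loss p c d (Finset.univ.erase q) - loss p c d Finset.univ) /
      (loss p c d ∅ - loss p c d {q})

/-- `(e^β - 1) / β`, with its limit `1` at `β = 0`. -/
def expRatio (β : ℝ) : ℝ := if β = 0 then 1 else (Real.exp β - 1) / β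

/-- The approximation ratio `α = (e^β - 1) / β` with `β = κ / (1 - κ)`, where `κ` is the
curvature (meaningful for `κ < 1`). -/
def approxRatio (p c : Fin m → ℝ) (d : Fin m → Fin m → ℝ) : ℝ :=
  expRatio (curvature p c d / (1 - curvature p c d))

/-- A rule that computes `argmin_{q ∈ S} f q`, with an arbitrary (measurable) way of breaking
ties. -/
structure ArgminRule (m : ℕ) where
  pick : Finset (Fin m) → (Fin m → ℝ) → Fin m
  pick_mem : ∀ (S : Finset (Fin m)) (f : Fin m → ℝ), S.Nonempty → pick S f ∈ S
  pick_le : ∀ (S : Finset (Fin m)) (f : Fin m → ℝ), ∀ q ∈ S, f (pick S f) ≤ f q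
  measurable_pick : ∀ S, Measurable (pick S)

/-- Reverse greedy: start with all queries cached and remove, `m - k` times, a query whose
removal leads to the smallest loss. -/
def reverseGreedy (R : ArgminRule m) (k : ℕ) (p c : Fin m → ℝ) (d : Fin m → Fin m → ℝ) :
    Finset (Fin m) :=
  (fun S : Finset (Fin m) => S.erase (R.pick S fun q => loss p c d (S.erase q)))^[m - k]
    Finset.univ

/-- The variables of the online algorithm between two rounds. Of the round index sets
`𝒯(q, τ)` and `𝒯(p, τ)` only the sizes matter. -/
structure State (m : ℕ) where
  /-- the current cache -/
  cache : Finset (Fin m)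
  /-- the lower confidence bounds computed at the last cache switch -/
  lcb : Fin m → ℝ
  /-- `N_p(q)`, the number of arrivals of `q` -/
  arrivals : Fin m → ℕ
  /-- `N_c(q)`, the number of observed serving costs of `q` -/
  obs : Fin m → ℕ
  /-- `L_c(q)`, the sum of the observed serving costs of `q` -/
  costSum : Fin m → ℝ
  /-- `|𝒯(q, τ_q)|` for the current stage `τ_q` of `q` -/
  cur : Fin m → ℕ
  /-- `∑_{τ < τ_q} |𝒯(q, τ)|` -/
  past : Fin m → ℕ
  /-- `|𝒯(p, τ_p)|` for the current stage `τ_p` of the arrival probabilities -/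
  curP : ℕ
  /-- `∑_{τ < τ_p} |𝒯(p, τ)|` -/
  pastP : ℕ

/-- The lower confidence bound of a cost with `n` observations of sum `s`. Without observations
it is `-∞`. Distances are nonnegative, so that every negative number acts as `-∞` (the LLM is
called whatever the cache is, and the cost has no influence on which cache is best); we
use `-1`. -/
def lowerBound (m T n : ℕ) (s : ℝ) : ℝ :=
  if n = 0 then -1
  else s / n - Real.sqrt (Real.log (4 * (m : ℝ) * (T : ℝ) ^ 3) / (2 * (n : ℝ)))

namespace State

/-- The initial state; the cache `M_0` is empty and there are no observations. -/
def init (m T : ℕ) : State m where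
  cache := ∅
  lcb := fun _ => lowerBound m T 0 0
  arrivals := fun _ => 0
  obs := fun _ => 0
  costSum := fun _ => 0
  cur := fun _ => 0
  past := fun _ => 0
  curP := 0
  pastP := 0

/-- The stage of `q` is complete:
`|𝒯(q, τ_q)| ≥ 1 + √(T ∑_{τ < τ_q} |𝒯(q, τ)| / m)`. -/
def QueryTrigger (T : ℕ) (s : State m) (q : Fin m) : Prop :=
  (s.cur q : ℝ) ≥ 1 + Real.sqrt ((T : ℝ) * (s.past q : ℝ) / (m : ℝ))

/-- The stage of the arrival probabilities is complete:
`|𝒯(p, τ_p)| ≥ 1 + √(T ∑_{τ < τ_p} |𝒯(p, τ)|)`. -/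
def ArrivalTrigger (T : ℕ) (s : State m) : Prop :=
  (s.curP : ℝ) ≥ 1 + Real.sqrt ((T : ℝ) * (s.pastP : ℝ))

open Classical in
/-- Begin a new stage for the queries whose stage is complete. -/
def newQueryStage (T : ℕ) (s : State m) : State m :=
  { s with
    cur := fun q => if s.QueryTrigger T q then 0 else s.cur q
    past := fun q => if s.QueryTrigger T q then s.past q + s.cur q else s.past q }

/-- Begin a new stage for the arrival probabilities. -/
def newArrivalStage (s : State m) : State m :=
  { s with curP := 0, pastP := s.pastP + s.curP }

/-- `Switch Cache` in round `t`: compute the empirical arrival frequencies `N_p(q) / t` and the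
lower confidence bounds, and run reverse greedy on them. -/
def switchCache (R : ArgminRule m) (k T t : ℕ) (d : Fin m → Fin m → ℝ) (s : State m) :
    State m :=
  { s with
    lcb := fun q => lowerBound m T (s.obs q) (s.costSum q)
    cache := reverseGreedy R k (fun q => (s.arrivals q : ℝ) / (t : ℝ))
      (fun q => lowerBound m T (s.obs q) (s.costSum q)) d }

open Classical in
/-- The first half of round `t`: decide whether to switch the cache. -/
def maybeSwitch (R : ArgminRule m) (k T t : ℕ) (d : Fin m → Fin m → ℝ) (s : State m) :
    State m :=
  if ∃ q, s.QueryTrigger T q then (s.newQueryStage T).switchCache R k T t d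
  else if s.ArrivalTrigger T then s.newArrivalStage.switchCache R k T t d
  else s

open Classical in
/-- `Serve and Update` for the arriving query `q`: if the lower confidence bound of `q` is
smaller than `d(q, M)`, then call the LLM and observe the cost `y`. -/
def serve (d : Fin m → Fin m → ℝ) (q : Fin m) (y : ℝ) (s : State m) : State m :=
  let s' : State m :=
    { s with
      arrivals := Function.update s.arrivals q (s.arrivals q + 1)
      curP := s.curP + 1 }
  if (s.lcb q : WithTop ℝ) < distTo d q s.cache then
    { s' with
      obs := Function.update s.obs q (s.obs q + 1)
      costSum := Function.update s.costSum q (s.costSum q + y)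
      cur := Function.update s.cur q (s.cur q + 1) }
  else s'

end State

/-- The state of the algorithm with cache size `k` and horizon `T` after `t` rounds, if the query
`query s` arrives in round `s = 1, 2, …` and `cost s q` is the cost of calling the LLM for `q` in
that round. -/
def run (R : ArgminRule m) (k T : ℕ) (d : Fin m → Fin m → ℝ) (query : ℕ → Fin m)
    (cost : ℕ → Fin m → ℝ) : ℕ → State m
  | 0 => State.init m T
  | t + 1 =>
    ((run R k T d query cost t).maybeSwitch R k T (t + 1) d).serve d (query (t + 1))
      (cost (t + 1) (query (t + 1)))

/-- The cache `M_t` of round `t` (`M_0 = ∅`). -/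
def cacheAt (R : ArgminRule m) (k T : ℕ) (d : Fin m → Fin m → ℝ) (query : ℕ → Fin m)
    (cost : ℕ → Fin m → ℝ) (t : ℕ) : Finset (Fin m) :=
  (run R k T d query cost t).cache

/-- Serving loss plus switching cost of the `T` rounds:
`∑_{t ∈ [T]} (ℓ(M_t; p, c, d) + ∑_{q ∈ M_t \ M_{t-1}} c(q))`. -/
def totalLoss (R : ArgminRule m) (k T : ℕ) (p c : Fin m → ℝ) (d : Fin m → Fin m → ℝ)
    (query : ℕ → Fin m) (cost : ℕ → Fin m → ℝ) : ℝ :=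
  ∑ t ∈ Finset.Icc 1 T,
    (loss p c d (cacheAt R k T d query cost t) +
      ∑ q ∈ cacheAt R k T d query cost t \ cacheAt R k T d query cost (t - 1), c q)

/-- Arrival probabilities, expected costs and distances as the caching model allows them. -/
structure IsModel (p c : Fin m → ℝ) (d : Fin m → Fin m → ℝ) : Prop where
  p_pos : ∀ q, 0 < p q
  p_sum : ∑ q, p q = 1
  c_pos : ∀ q, 0 < c q
  c_le_one : ∀ q, c q ≤ 1
  d_nonneg : ∀ q u, 0 ≤ d q u
  d_self : ∀ q, d q q = 0

/-- The randomness of the environment: in round `t` the query `query t` has law `p`, and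
`cost t q` is `c q` plus zero-mean sub-Gaussian noise with variance proxy `1/4`. The rounds are
independent, and in each round the arriving query is independent of the costs. -/
structure IsEnvironment {Ω : Type*} [MeasurableSpace Ω] (μ : Measure Ω) (p c : Fin m → ℝ)
    (query : ℕ → Ω → Fin m) (cost : ℕ → Ω → Fin m → ℝ) : Prop where
  measurable_query : ∀ t, Measurable (query t)
  measurable_cost : ∀ t, Measurable (cost t)
  law_query : ∀ t q, μ.real {ω | query t ω = q} = p q
  mean_cost : ∀ t q, ∫ ω, cost t ω q ∂μ = c q
  noise : ∀ t q, HasSubgaussianMGF (fun ω => cost t ω q - c q) (1 / 4) μ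
  indep_rounds : iIndepFun (fun t ω => (query t ω, cost t ω)) μ
  indep_query_cost : ∀ t, IndepFun (query t) (cost t) μ

/-- The total loss as a random variable. -/
def randomLoss {Ω : Type*} (R : ArgminRule m) (k T : ℕ) (p c : Fin m → ℝ)
    (d : Fin m → Fin m → ℝ) (query : ℕ → Ω → Fin m) (cost : ℕ → Ω → Fin m → ℝ) (ω : Ω) : ℝ :=
  totalLoss R k T p c d (fun t => query t ω) (fun t => cost t ω)

/-- The `α`-approximate regret with switching cost,
`E [∑_t (ℓ(M_t) + ∑_{q ∈ M_t \ M_{t-1}} c(q))] - ∑_t α ℓ(M*)`. -/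
def regret {Ω : Type*} [MeasurableSpace Ω] (μ : Measure Ω) (R : ArgminRule m) (k T : ℕ)
    (p c : Fin m → ℝ) (d : Fin m → Fin m → ℝ) (query : ℕ → Ω → Fin m)
    (cost : ℕ → Ω → Fin m → ℝ) : ℝ :=
  (∫ ω, randomLoss R k T p c d query cost ω ∂μ) -
    ∑ _t ∈ Finset.Icc 1 T, approxRatio p c d * optLoss k p c d

end SemanticCaching

end

/-! The regret of the online algorithm is the sum of two estimation errors and of the cost of refilling
the cache.

*Reverse greedy with an inexact objective* (`greedy_le`, `loss_reverseGreedy_le`). As a function of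
the set of uncached queries, the loss is monotone and supermodular, and the curvature bounds a
marginal loss by `1 + β` times the loss of the single query. This gives the recursion whose solution
is `(e^β - 1) / β`. The algorithm runs reverse greedy on estimates, of whose curvature nothing is
known. The proof uses the curvature of the true loss only, and goes back and forth between the true
and the estimated loss at the level of values of sets. Hence the error is not multiplied by the
number of steps. It enters from two sides: the estimated loss must not exceed the true one, which
holds for optimistic costs up to the `ℓ¹`-error of the arrival frequencies, and it must not be much
smaller for the caches that contain the final one. There, a query that is served from the cache has
an optimistic cost above its distance to the cache, so that its cost does not matter. Only the
confidence widths of the queries that are sent to the LLM count.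

*Stages* (`stage_count_le`). A stage of a query with `s` past observations has about `√(T s / m)` new
ones, so that each stage adds at most about `√(T log (m T) / m)` to the sum of the confidence widths.
Until `T / m` observations are reached, the exponent of `s` gets halfway to its goal in every stage,
which takes `log log T` stages. After that, `√s` grows by about `√(T / m)` in every stage, and by
the Cauchy-Schwarz inequality there are at most `O(m)` such stages over all queries. The same holds
for the arrivals, with `T` in place of `T / m`. Every switch ends a stage and costs at most `m`.

*Probability* (`IsEnvironment.measure_not_isGood_le`, `IsEnvironment.integral_observedWidth`). Which
costs are observed depends on the past and on the arriving query, but not on the cost. Therefore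
`exp (x (S - n c) - n x² / 8)` is a supermartingale, for the sum `S` of the `n` observations of a
query, and the observed means stay within the confidence widths. The `ℓ¹`-error of the arrival
frequencies is controlled by Hoeffding's inequality for each of the `2 ^ m` vectors of signs. The
bad event has a probability of order `1 / T`, which makes its contribution bounded. Finally, the
expected sum of the widths over all queries equals that over the arriving ones, by independence of
the arriving query from the past. -/

namespace SemanticCaching

/-! ### Reverse greedy with an inexact objective -/

/-- `(e^{βu} - 1) / β`, with its limit `u` at `β = 0`. This is the solution of `y' = 1 + β y`,
`y(0) = 0`, the continuous counterpart of the recursion behind the greedy bound. -/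
noncomputable def expGrowth (β u : ℝ) : ℝ := if β = 0 then u else (Real.exp (β * u) - 1) / β

lemma expGrowth_one (β : ℝ) : expGrowth β 1 = expRatio β := by
  simp [expGrowth, expRatio]

lemma expGrowth_zero (β : ℝ) : expGrowth β 0 = 0 := by
  simp [expGrowth]

lemma sub_le_expGrowth_sub {β u v : ℝ} (hβ : 0 ≤ β) (hv : 0 ≤ v) (hvu : v ≤ u) :
    u - v ≤ expGrowth β u - expGrowth β v := by
  unfold expGrowth
  split_ifs with h
  · exact le_rfl
  have hβ' : 0 < β := lt_of_le_of_ne hβ (Ne.symm h)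
  rw [← sub_div, le_div_iff₀ hβ']
  have h1 : Real.exp (β * u) = Real.exp (β * v) * Real.exp (β * (u - v)) := by
    rw [← Real.exp_add]; ring_nf
  have h2 := Real.add_one_le_exp (β * (u - v))
  have h3 : 1 ≤ Real.exp (β * v) := Real.one_le_exp (by positivity)
  have h4 : 0 ≤ β * (u - v) := mul_nonneg hβ (by linarith)
  rw [h1]
  nlinarith [mul_nonneg (sub_nonneg.2 h3) h4]

lemma le_expGrowth {β u : ℝ} (hβ : 0 ≤ β) (hu : 0 ≤ u) : u ≤ expGrowth β u := by
  have := sub_le_expGrowth_sub hβ le_rfl hu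
  rw [expGrowth_zero] at this
  linarith

lemma expGrowth_mono {β u v : ℝ} (hβ : 0 ≤ β) (hv : 0 ≤ v) (hvu : v ≤ u) :
    expGrowth β v ≤ expGrowth β u := by
  have := sub_le_expGrowth_sub hβ hv hvu
  linarith

/-- One Euler step of `y' = 1 + β y` stays below the exact solution. -/
lemma expGrowth_step {β x u : ℝ} (hβ : 0 ≤ β) :
    x + (1 + β * x) * expGrowth β u ≤ expGrowth β (u + x) := by
  unfold expGrowth
  split_ifs with h
  · subst h; linarith
  have hβ' : 0 < β := lt_of_le_of_ne hβ (Ne.symm h)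
  rw [le_div_iff₀ hβ']
  have h1 : Real.exp (β * (u + x)) = Real.exp (β * u) * Real.exp (β * x) := by
    rw [← Real.exp_add]; ring_nf
  have h2 := Real.add_one_le_exp (β * x)
  have h3 := mul_le_mul_of_nonneg_left h2 (Real.exp_pos (β * u)).le
  have h4 : (x + (1 + β * x) * ((Real.exp (β * u) - 1) / β)) * β
      = Real.exp (β * u) * (β * x + 1) - 1 := by
    field_simp
    ring
  rw [h4, h1]
  linarith

lemma one_add_half_le_expRatio {β : ℝ} (hβ : 0 ≤ β) : 1 + β / 2 ≤ expRatio β := by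
  unfold expRatio
  split_ifs with h
  · subst h; simp
  have hβ' : 0 < β := lt_of_le_of_ne hβ (Ne.symm h)
  rw [le_div_iff₀ hβ']
  have := Real.quadratic_le_exp_of_nonneg hβ
  nlinarith

/-- The recursion of reverse greedy. `δ i` is the loss of the `i`-th removal, and `hit i` says
that this removal also belongs to the optimal set of `r` removals. A hit lowers both the budget
and the number of the optimal removals that are left. -/
lemma sum_le_of_greedy_recursion {β : ℝ} (hβ : 0 ≤ β) (s : ℕ) :
    ∀ (r : ℕ) (D : ℝ) (δ : ℕ → ℝ) (hit : ℕ → Prop) [DecidablePred hit], s ≤ r → 0 ≤ D →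
      (∀ i < s, 0 ≤ δ i) →
      (∀ i < s, ((r : ℝ) - ∑ j ∈ Finset.range i, if hit j then 1 else 0) * δ i ≤
        D + ∑ j ∈ Finset.range i, if hit j then - δ j else β * δ j) →
      ∑ i ∈ Finset.range s, δ i ≤ D * expGrowth β (s / r) := by
  induction s with
  | zero =>
    intro r D δ hit _ _ _ _ _
    simp [expGrowth_zero]
  | succ s ih =>
    intro r D δ hit _ hsr hD hδ hrec
    have hr : (0 : ℝ) < r := by exact_mod_cast lt_of_lt_of_le (Nat.succ_pos s) hsr
    have hs0 : (0 : ℝ) ≤ s := s.cast_nonneg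
    have hsr' : (s : ℝ) + 1 ≤ r := by exact_mod_cast hsr
    have h0 : r * δ 0 ≤ D := by simpa using hrec 0 (Nat.succ_pos s)
    have hδ0 : 0 ≤ δ 0 := hδ 0 (Nat.succ_pos s)
    rw [Finset.sum_range_succ']
    by_cases hh : hit 0
    · have hD' : 0 ≤ D - δ 0 := by nlinarith
      have key := ih (r - 1) (D - δ 0) (fun i => δ (i + 1)) (fun i => hit (i + 1)) (by omega) hD'
        (fun i hi => hδ _ (by omega)) (fun i hi => by
          have := hrec (i + 1) (by omega)
          rw [Finset.sum_range_succ', Finset.sum_range_succ' (fun j => if hit j then -δ j else _)]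
            at this
          simp only [hh, if_true] at this
          rw [Nat.cast_sub (by omega)]
          push_cast
          calc _ = ((r : ℝ) - (∑ j ∈ Finset.range i, (if hit (j + 1) then 1 else 0) + 1))
                * δ (i + 1) := by ring
            _ ≤ _ := this
            _ = _ := by ring)
      rw [Nat.cast_sub (by omega), Nat.cast_one] at key
      set u : ℝ := ((s + 1 : ℕ) : ℝ) / r with hu
      set v : ℝ := (s : ℝ) / ((r : ℝ) - 1) with hv
      have hv0 : 0 ≤ v := div_nonneg hs0 (by linarith)
      -- the remaining fraction `u` is a mean of `1` (weight `1 / r`) and of the new fraction `v`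
      have huv : u - v = (1 - v) / r := by
        rw [hu, hv]
        rcases Nat.eq_zero_or_pos s with hs | hs
        · subst hs; simp
        have : (r : ℝ) - 1 ≠ 0 := by
          have : (1 : ℝ) ≤ s := by exact_mod_cast hs
          linarith
        push_cast
        field_simp
        ring
      have hv1 : v ≤ 1 := div_le_one_of_le₀ (by linarith) (by linarith)
      have hvu : v ≤ u := by
        have : 0 ≤ (1 - v) / r := div_nonneg (by linarith) hr.le
        linarith
      have hE := sub_le_expGrowth_sub hβ hv0 hvu
      have hEv := le_expGrowth hβ hv0
      have hEv0 : 0 ≤ expGrowth β v := hv0.trans hEv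
      have e1 : ∑ i ∈ Finset.range s, δ (i + 1) + δ 0 ≤
          D * expGrowth β v + δ 0 * (1 - expGrowth β v) := by linarith
      refine e1.trans ?_
      have hmono := expGrowth_mono hβ hv0 hvu
      rcases le_total (expGrowth β v) 1 with hle | hle
      · have e2 : δ 0 * (1 - expGrowth β v) ≤ D / r * (1 - v) := by
          apply mul_le_mul _ (by linarith) (by linarith) (by positivity)
          rw [le_div_iff₀ hr]; linarith
        have e3 : D / r * (1 - v) = D * (u - v) := by rw [huv]; ring
        nlinarith
      · nlinarith [mul_nonneg hδ0 (sub_nonneg.2 hle)]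
    · have key := ih r (D + β * δ 0) (fun i => δ (i + 1)) (fun i => hit (i + 1)) (by omega)
        (by positivity)
        (fun i hi => hδ _ (by omega)) (fun i hi => by
          have := hrec (i + 1) (by omega)
          rw [Finset.sum_range_succ', Finset.sum_range_succ' (fun j => if hit j then -δ j else _)]
            at this
          simp only [hh, if_false] at this
          linarith)
      have hstep := expGrowth_step (x := 1 / r) (u := s / r) hβ
      have e0 : (s : ℝ) / r + 1 / r = ((s + 1 : ℕ) : ℝ) / r := by push_cast; ring
      rw [e0] at hstep
      have hE0 : 0 ≤ expGrowth β (s / r) := le_trans (by positivity) (le_expGrowth hβ (by positivity))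
      have e1 : δ 0 ≤ D * (1 / r) := by
        rw [mul_one_div, le_div_iff₀ hr]; linarith
      have e2 := mul_le_mul_of_nonneg_left hstep hD
      have e3 : β * δ 0 * expGrowth β (s / r) ≤ β * (D * (1 / r)) * expGrowth β (s / r) := by
        gcongr
      nlinarith

section Supermodular

variable {ι : Type*} [DecidableEq ι]

/-- Supermodularity, in the form of increasing marginal values. -/
def IsSupermodular (h : Finset ι → ℝ) : Prop :=
  ∀ X Y : Finset ι, X ⊆ Y → ∀ y ∉ Y, h (insert y X) - h X ≤ h (insert y Y) - h Y

lemma IsSupermodular.sum_marginal_le {h : Finset ι → ℝ} (hh : IsSupermodular h)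
    (Y S : Finset ι) (hd : Disjoint Y S) :
    ∑ z ∈ S, (h (insert z Y) - h Y) ≤ h (Y ∪ S) - h Y := by
  induction S using Finset.induction_on with
  | empty => simp
  | insert a S ha ih =>
    rw [Finset.disjoint_insert_right] at hd
    have h1 := ih hd.2
    have h2 := hh Y (Y ∪ S) Finset.subset_union_left a (by simp [hd.1, ha])
    rw [Finset.sum_insert ha, Finset.union_insert]
    linarith

lemma union_le_of_marginal_le {g : Finset ι → ℝ} {b : ℝ}
    (hg : ∀ Y : Finset ι, ∀ y ∉ Y, g (insert y Y) - g Y ≤ b * g {y})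
    (Z N : Finset ι) (hd : Disjoint Z N) :
    g (Z ∪ N) ≤ g Z + b * ∑ y ∈ N, g {y} := by
  induction N using Finset.induction_on with
  | empty => simp
  | insert a N ha ih =>
    rw [Finset.disjoint_insert_right] at hd
    have h1 := ih hd.2
    have h2 := hg (Z ∪ N) a (by simp [hd.1, ha])
    rw [Finset.sum_insert ha, Finset.union_insert]
    linarith

/-- Greedy minimization of a supermodular function `h` that approximates `g`: `h` exceeds `g` by
at most `e₁`, and falls below `g` by at most `e₂`, the latter only on the subsets of the greedy
solution. The errors are not multiplied by the number of steps, because a step uses them only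
through the values of the sets `Y i`, `Y i \ Z` and `Z ∪ Y i`, and not through the increments. -/
theorem greedy_le {g h : Finset ι → ℝ} {β e₁ e₂ : ℝ} (hβ : 0 ≤ β) (he₁ : 0 ≤ e₁) (he₂ : 0 ≤ e₂)
    (g_empty : g ∅ = 0) (h_empty : h ∅ = 0) (g_nonneg : ∀ Y, 0 ≤ g Y)
    (h_mono : ∀ (Y : Finset ι) (y : ι), h Y ≤ h (insert y Y))
    (hg : IsSupermodular g) (hh : IsSupermodular h)
    (hcurv : ∀ Y : Finset ι, ∀ y ∉ Y, g (insert y Y) - g Y ≤ (1 + β) * g {y})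
    (r : ℕ) (Y : ℕ → Finset ι) (y : ℕ → ι) (Y_zero : Y 0 = ∅)
    (Y_succ : ∀ i < r, Y (i + 1) = insert (y i) (Y i)) (y_notMem : ∀ i < r, y i ∉ Y i)
    (hmin : ∀ i < r, ∀ z ∉ Y i, h (insert (y i) (Y i)) ≤ h (insert z (Y i)))
    (h_le : ∀ X, h X ≤ g X + e₁) (g_le : ∀ X ⊆ Y r, g X ≤ h X + e₂)
    (Z : Finset ι) (hZ : Z.card = r) :
    g (Y r) ≤ expRatio β * (g Z + e₁ + (1 + β) * e₂) + e₂ := by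
  have hsub : ∀ n ≤ r, ∀ i ≤ n, Y i ⊆ Y n := by
    intro n
    induction n with
    | zero => intro _ i hi; rw [Nat.le_zero.1 hi]
    | succ n ih =>
      intro hn i hi
      rcases Nat.lt_or_eq_of_le hi with hlt | heq
      · rw [Y_succ n (by omega)]
        exact (ih (by omega) i (by omega)).trans (Finset.subset_insert _ _)
      · rw [heq]
  set δ : ℕ → ℝ := fun i => h (Y (i + 1)) - h (Y i) with hδdef
  have hδ : ∀ i < r, 0 ≤ δ i := fun i hi => by
    simp only [hδdef, Y_succ i hi]
    linarith [h_mono (Y i) (y i)]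
  have hsum : ∀ i, ∑ j ∈ Finset.range i, δ j = h (Y i) := fun i => by
    rw [Finset.sum_range_sub (fun i => h (Y i)), Y_zero, h_empty, sub_zero]
  have hcard : ∀ i ≤ r, ((Z \ Y i).card : ℝ) =
      (r : ℝ) - ∑ j ∈ Finset.range i, if y j ∈ Z then 1 else 0 := by
    intro i
    induction i with
    | zero => intro _; simp [Y_zero, hZ]
    | succ i ih =>
      intro hi
      have h1 := ih (by omega)
      rw [Finset.sum_range_succ, Y_succ i (by omega)]
      have h2 : Z \ insert (y i) (Y i) = (Z \ Y i).erase (y i) := by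
        ext x; simp only [Finset.mem_sdiff, Finset.mem_insert, Finset.mem_erase]; tauto
      rw [h2]
      split_ifs with hy
      · have hmem : y i ∈ Z \ Y i := by simp [hy, y_notMem i (by omega)]
        have h3 := Finset.card_erase_add_one hmem
        have h4 : (((Z \ Y i).erase (y i)).card : ℝ) + 1 = (Z \ Y i).card := by exact_mod_cast h3
        linarith
      · rw [Finset.erase_eq_of_notMem (by simp [hy]), h1]; ring
  have hmiss : ∀ i ≤ r, h (Y i \ Z) ≤ ∑ j ∈ Finset.range i, if y j ∈ Z then 0 else δ j := by
    intro i
    induction i with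
    | zero => intro _; simp [Y_zero, h_empty]
    | succ i ih =>
      intro hi
      have h1 := ih (by omega)
      rw [Finset.sum_range_succ, Y_succ i (by omega)]
      split_ifs with hy
      · rw [Finset.insert_sdiff_of_mem _ hy]; linarith
      · rw [Finset.insert_sdiff_of_notMem _ hy]
        have h2 := hh (Y i \ Z) (Y i) Finset.sdiff_subset (y i) (y_notMem i (by omega))
        simp only [hδdef, Y_succ i (show i < r by omega)]
        linarith
  have hD : 0 ≤ g Z + e₁ + (1 + β) * e₂ := by
    have := g_nonneg Z
    positivity
  have key := sum_le_of_greedy_recursion hβ r r (g Z + e₁ + (1 + β) * e₂) δ (fun j => y j ∈ Z)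
    le_rfl hD hδ (fun i hi => by
      rw [← hcard i hi.le]
      have h1 : ((Z \ Y i).card : ℝ) * δ i ≤ ∑ z ∈ Z \ Y i, (h (insert z (Y i)) - h (Y i)) := by
        rw [← nsmul_eq_mul, ← Finset.sum_const]
        refine Finset.sum_le_sum fun z hz => ?_
        simp only [hδdef, Y_succ i hi]
        linarith [hmin i hi z (Finset.mem_sdiff.1 hz).2]
      have h2 := hh.sum_marginal_le (Y i) (Z \ Y i) Finset.disjoint_sdiff
      have h3 : Y i ∪ Z \ Y i = Z ∪ Y i \ Z := by
        ext x; simp only [Finset.mem_union, Finset.mem_sdiff]; tauto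
      rw [h3] at h2
      have h4 := h_le (Z ∪ Y i \ Z)
      have h5 := union_le_of_marginal_le hcurv Z (Y i \ Z) Finset.disjoint_sdiff
      have h6 := hg.sum_marginal_le ∅ (Y i \ Z) (by simp)
      simp only [insert_empty_eq, g_empty, sub_zero, Finset.empty_union] at h6
      have h7 := g_le (Y i \ Z) (Finset.sdiff_subset.trans (hsub r le_rfl i hi.le))
      have h8 := hmiss i hi.le
      have h9 : ∑ y ∈ Y i \ Z, g {y} ≤
          (∑ j ∈ Finset.range i, if y j ∈ Z then 0 else δ j) + e₂ := by linarith
      have h10 := mul_le_mul_of_nonneg_left h9 (show 0 ≤ 1 + β by linarith)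
      have h11 : (∑ j ∈ Finset.range i, if y j ∈ Z then - δ j else β * δ j) =
          (1 + β) * (∑ j ∈ Finset.range i, if y j ∈ Z then 0 else δ j) - h (Y i) := by
        rw [← hsum i, Finset.mul_sum, ← Finset.sum_sub_distrib]
        refine Finset.sum_congr rfl fun j _ => ?_
        split_ifs <;> ring
      rw [h11]
      linarith)
  rw [hsum r] at key
  have hE : expGrowth β ((r : ℝ) / r) ≤ expRatio β := by
    rw [← expGrowth_one]
    exact expGrowth_mono hβ (by positivity) (div_self_le_one _)
  have := g_le (Y r) subset_rfl
  have := mul_le_mul_of_nonneg_left hE hD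
  linarith

end Supermodular

variable {m : ℕ}

/-! ### The loss of a cache -/

lemma coe_serveLoss (x : ℝ) (d : Fin m → Fin m → ℝ) (q : Fin m) (M : Finset (Fin m)) :
    (serveLoss x d q M : WithTop ℝ) = min (x : WithTop ℝ) (distTo d q M) := by
  unfold serveLoss
  have h : min (x : WithTop ℝ) (distTo d q M) ≠ ⊤ :=
    ((min_le_left _ _).trans_lt (WithTop.coe_lt_top x)).ne
  obtain ⟨y, hy⟩ := WithTop.ne_top_iff_exists.1 h
  rw [← hy, WithTop.untopD_coe]

lemma serveLoss_empty (x : ℝ) (d : Fin m → Fin m → ℝ) (q : Fin m) : serveLoss x d q ∅ = x := by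
  simp [serveLoss, distTo]

lemma serveLoss_insert (x : ℝ) (d : Fin m → Fin m → ℝ) (q u : Fin m) (M : Finset (Fin m)) :
    serveLoss x d q (insert u M) = min (serveLoss x d q M) (d q u) := by
  rw [← WithTop.coe_inj, WithTop.coe_min, coe_serveLoss, coe_serveLoss, min_assoc,
    min_comm (distTo d q M), distTo, Finset.inf_insert]
  rfl

lemma serveLoss_le (x : ℝ) (d : Fin m → Fin m → ℝ) (q : Fin m) (M : Finset (Fin m)) :
    serveLoss x d q M ≤ x := by
  rw [← WithTop.coe_le_coe, coe_serveLoss]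
  exact min_le_left _ _

lemma serveLoss_nonneg {x : ℝ} {d : Fin m → Fin m → ℝ} (hx : 0 ≤ x) (hd : ∀ q u, 0 ≤ d q u)
    (q : Fin m) (M : Finset (Fin m)) : 0 ≤ serveLoss x d q M := by
  induction M using Finset.induction_on with
  | empty => rwa [serveLoss_empty]
  | insert u M _ ih => rw [serveLoss_insert]; exact le_min ih (hd q u)

lemma serveLoss_mono_cost {x y : ℝ} (hxy : x ≤ y) (d : Fin m → Fin m → ℝ) (q : Fin m)
    (M : Finset (Fin m)) : serveLoss x d q M ≤ serveLoss y d q M := by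
  rw [← WithTop.coe_le_coe, coe_serveLoss, coe_serveLoss]
  exact min_le_min_right _ (WithTop.coe_le_coe.2 hxy)

lemma serveLoss_le_add {x y w : ℝ} (hw : 0 ≤ w) (hxy : x ≤ y + w) (d : Fin m → Fin m → ℝ)
    (q : Fin m) (M : Finset (Fin m)) : serveLoss x d q M ≤ serveLoss y d q M + w := by
  induction M using Finset.induction_on with
  | empty => rwa [serveLoss_empty, serveLoss_empty]
  | insert u M _ ih =>
    rw [serveLoss_insert, serveLoss_insert, ← min_add_add_right]
    exact min_le_min ih (by linarith)

/-- Negative costs can be replaced by `0`: this changes the loss by a constant. -/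
lemma serveLoss_eq_pos_part {x : ℝ} {d : Fin m → Fin m → ℝ} (hd : ∀ q u, 0 ≤ d q u)
    (q : Fin m) (M : Finset (Fin m)) :
    serveLoss x d q M = serveLoss (max x 0) d q M + min x 0 := by
  rcases le_total 0 x with hx | hx
  · simp [hx]
  · rw [max_eq_right hx, min_eq_left hx]
    induction M using Finset.induction_on with
    | empty => simp [serveLoss_empty]
    | insert u M _ ih =>
      have h0 := serveLoss_nonneg le_rfl hd q M
      have h1 := serveLoss_le 0 d q M
      rw [serveLoss_insert, serveLoss_insert, ih, min_eq_left, min_eq_left]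
      · linarith [hd q u]
      · linarith [hd q u]

lemma serveLoss_anti (x : ℝ) (d : Fin m → Fin m → ℝ) (q : Fin m) {M M' : Finset (Fin m)}
    (h : M ⊆ M') : serveLoss x d q M' ≤ serveLoss x d q M := by
  rw [← WithTop.coe_le_coe, coe_serveLoss, coe_serveLoss]
  exact min_le_min_left _ (Finset.inf_mono h)

/-- If the distance to the cache is at most the cost, the cost does not enter the loss. -/
lemma serveLoss_le_of_distTo_le {x y : ℝ} {d : Fin m → Fin m → ℝ} {q : Fin m}
    {M : Finset (Fin m)} (h : distTo d q M ≤ (y : WithTop ℝ)) :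
    serveLoss x d q M ≤ serveLoss y d q M := by
  rw [← WithTop.coe_le_coe, coe_serveLoss, coe_serveLoss]
  exact le_min ((min_le_right _ _).trans h) (min_le_right _ _)

lemma serveLoss_univ {x : ℝ} {d : Fin m → Fin m → ℝ} (hx : 0 ≤ x) (hd : ∀ q u, 0 ≤ d q u)
    (hself : ∀ q, d q q = 0) (q : Fin m) : serveLoss x d q Finset.univ = 0 := by
  refine le_antisymm ?_ (serveLoss_nonneg hx hd q _)
  rw [← Finset.insert_eq_of_mem (Finset.mem_univ q), serveLoss_insert, hself]
  exact min_le_right _ _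

/-- The loss as a function of the set of queries that are not cached. -/
noncomputable def uncachedLoss (p c : Fin m → ℝ) (d : Fin m → Fin m → ℝ) (Y : Finset (Fin m)) : ℝ :=
  loss p c d Yᶜ

lemma uncachedLoss_insert (p c : Fin m → ℝ) (d : Fin m → Fin m → ℝ) {Y : Finset (Fin m)}
    {y : Fin m} (hy : y ∉ Y) :
    uncachedLoss p c d (insert y Y) - uncachedLoss p c d Y =
      ∑ q, p q * max 0 (serveLoss (c q) d q (insert y Y)ᶜ - d q y) := by
  have h : Yᶜ = insert y (insert y Y)ᶜ := by
    ext x; by_cases hx : x = y <;> simp [hx, hy]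
  unfold uncachedLoss loss
  rw [h, ← Finset.sum_sub_distrib]
  refine Finset.sum_congr rfl fun q _ => ?_
  rw [serveLoss_insert, ← mul_sub]
  congr 1
  rcases le_total (serveLoss (c q) d q (insert y Y)ᶜ) (d q y) with h' | h'
  · rw [min_eq_left h', max_eq_left (by linarith), sub_self]
  · rw [min_eq_right h', max_eq_right (by linarith)]

lemma isSupermodular_uncachedLoss {p : Fin m → ℝ} (hp : ∀ q, 0 ≤ p q) (c : Fin m → ℝ)
    (d : Fin m → Fin m → ℝ) : IsSupermodular (uncachedLoss p c d) := by
  intro X Y hXY y hy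
  rw [uncachedLoss_insert p c d hy, uncachedLoss_insert p c d fun h => hy (hXY h)]
  refine Finset.sum_le_sum fun q _ => mul_le_mul_of_nonneg_left ?_ (hp q)
  refine max_le_max le_rfl (sub_le_sub_right (serveLoss_anti _ _ _ ?_) _)
  rw [Finset.compl_subset_compl]
  exact Finset.insert_subset_insert _ hXY

lemma loss_anti {p : Fin m → ℝ} (hp : ∀ q, 0 ≤ p q) (c : Fin m → ℝ)
    (d : Fin m → Fin m → ℝ) {M M' : Finset (Fin m)} (h : M ⊆ M') :
    loss p c d M' ≤ loss p c d M :=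
  Finset.sum_le_sum fun q _ => mul_le_mul_of_nonneg_left (serveLoss_anti _ _ _ h) (hp q)

lemma loss_eq_pos_part (p c : Fin m → ℝ) {d : Fin m → Fin m → ℝ} (hd : ∀ q u, 0 ≤ d q u)
    (M : Finset (Fin m)) :
    loss p c d M = loss p (fun q => max (c q) 0) d M + ∑ q, p q * min (c q) 0 := by
  unfold loss
  rw [← Finset.sum_add_distrib]
  refine Finset.sum_congr rfl fun q _ => ?_
  rw [serveLoss_eq_pos_part hd q M, mul_add]

lemma loss_sub_le {p p' c : Fin m → ℝ} {d : Fin m → Fin m → ℝ} (hd : ∀ q u, 0 ≤ d q u)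
    (hc : ∀ q, 0 ≤ c q) (hc1 : ∀ q, c q ≤ 1) (M : Finset (Fin m)) :
    loss p c d M ≤ loss p' c d M + ∑ q, |p' q - p q| := by
  unfold loss
  rw [← Finset.sum_add_distrib]
  refine Finset.sum_le_sum fun q _ => ?_
  have h0 := serveLoss_nonneg (hc q) hd q M
  have h1 := (serveLoss_le (c q) d q M).trans (hc1 q)
  have h2 := neg_abs_le (p' q - p q)
  have h3 := abs_nonneg (p' q - p q)
  nlinarith

lemma loss_nonneg {p c : Fin m → ℝ} {d : Fin m → Fin m → ℝ} (hp : ∀ q, 0 ≤ p q)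
    (hd : ∀ q u, 0 ≤ d q u) (hc : ∀ q, 0 ≤ c q) (M : Finset (Fin m)) : 0 ≤ loss p c d M :=
  Finset.sum_nonneg fun q _ => mul_nonneg (hp q) (serveLoss_nonneg (hc q) hd q M)

lemma IsModel.loss_nonneg {p c : Fin m → ℝ} {d : Fin m → Fin m → ℝ} (hM : IsModel p c d)
    (M : Finset (Fin m)) : 0 ≤ loss p c d M :=
  SemanticCaching.loss_nonneg (fun q => (hM.p_pos q).le) hM.d_nonneg (fun q => (hM.c_pos q).le) M

lemma IsModel.loss_le_one {p c : Fin m → ℝ} {d : Fin m → Fin m → ℝ} (hM : IsModel p c d)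
    (M : Finset (Fin m)) : loss p c d M ≤ 1 := by
  rw [← hM.p_sum]
  refine Finset.sum_le_sum fun q _ => ?_
  have := (serveLoss_le (c q) d q M).trans (hM.c_le_one q)
  nlinarith [hM.p_pos q]

lemma loss_univ {p c : Fin m → ℝ} {d : Fin m → Fin m → ℝ} (hd : ∀ q u, 0 ≤ d q u)
    (hself : ∀ q, d q q = 0) (hc : ∀ q, 0 ≤ c q) : loss p c d Finset.univ = 0 :=
  Finset.sum_eq_zero fun q _ => by rw [serveLoss_univ (hc q) hd hself, mul_zero]

lemma optLoss_nonneg {p c : Fin m → ℝ} {d : Fin m → Fin m → ℝ} (hM : IsModel p c d) (k : ℕ) :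
    0 ≤ optLoss k p c d :=
  (Finset.le_inf'_iff _ _).2 fun M _ => hM.loss_nonneg M

/-! ### Curvature and the approximation ratio -/

lemma IsModel.pos {p c : Fin m → ℝ} {d : Fin m → Fin m → ℝ} (hM : IsModel p c d) : 0 < m := by
  rcases Nat.eq_zero_or_pos m with h | h
  · subst h
    have := hM.p_sum
    simp at this
  · exact h

lemma loss_empty_sub_loss_singleton_pos {p c : Fin m → ℝ} {d : Fin m → Fin m → ℝ}
    (hM : IsModel p c d) (q : Fin m) : 0 < loss p c d ∅ - loss p c d {q} := by
  unfold loss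
  rw [← Finset.sum_sub_distrib]
  have hle : ∀ i, 0 ≤ p i * serveLoss (c i) d i ∅ - p i * serveLoss (c i) d i {q} := fun i =>
    sub_nonneg.2 (mul_le_mul_of_nonneg_left (serveLoss_anti _ _ _ (Finset.empty_subset _))
      (hM.p_pos i).le)
  refine Finset.sum_pos' (fun i _ => hle i) ⟨q, Finset.mem_univ q, ?_⟩
  rw [← insert_empty_eq, serveLoss_insert, serveLoss_empty, hM.d_self, min_eq_right (hM.c_pos q).le,
    mul_zero, sub_zero]
  exact mul_pos (hM.p_pos q) (hM.c_pos q)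

lemma one_sub_curvature_mul_le {p c : Fin m → ℝ} {d : Fin m → Fin m → ℝ}
    (hM : IsModel p c d) (q : Fin m) :
    (1 - curvature p c d) * (loss p c d ∅ - loss p c d {q}) ≤ uncachedLoss p c d {q} := by
  have h := ciInf_le (Set.finite_range fun q : Fin m =>
    (loss p c d (Finset.univ.erase q) - loss p c d Finset.univ) /
      (loss p c d ∅ - loss p c d {q})).bddBelow q
  have e : ({q} : Finset (Fin m))ᶜ = Finset.univ.erase q := by ext; simp
  rw [le_div_iff₀ (loss_empty_sub_loss_singleton_pos hM q)] at h
  rw [uncachedLoss, e, curvature, sub_sub_cancel]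
  refine h.trans ?_
  rw [loss_univ hM.d_nonneg hM.d_self fun q => (hM.c_pos q).le, sub_zero]

lemma uncachedLoss_empty {p c : Fin m → ℝ} {d : Fin m → Fin m → ℝ} (hd : ∀ q u, 0 ≤ d q u)
    (hself : ∀ q, d q q = 0) (hc : ∀ q, 0 ≤ c q) : uncachedLoss p c d ∅ = 0 := by
  rw [uncachedLoss, Finset.compl_empty, loss_univ hd hself hc]

lemma uncachedLoss_marginal_le {p c : Fin m → ℝ} {d : Fin m → Fin m → ℝ}
    (hM : IsModel p c d) {Y : Finset (Fin m)} {y : Fin m} (hy : y ∉ Y) :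
    uncachedLoss p c d (insert y Y) - uncachedLoss p c d Y ≤ loss p c d ∅ - loss p c d {y} := by
  have h := isSupermodular_uncachedLoss (fun q => (hM.p_pos q).le) c d Y {y}ᶜ
    (by simpa using hy) y (by simp)
  have e : insert y ({y} : Finset (Fin m))ᶜ = Finset.univ := by ext x; simp
  rw [e] at h
  simpa [uncachedLoss] using h

lemma curvature_nonneg {p c : Fin m → ℝ} {d : Fin m → Fin m → ℝ} (hM : IsModel p c d) :
    0 ≤ curvature p c d := by
  by_contra! hneg
  let q : Fin m := ⟨0, hM.pos⟩
  have h1 := one_sub_curvature_mul_le hM q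
  have h2 := uncachedLoss_marginal_le hM (Finset.notMem_empty q)
  rw [uncachedLoss_empty hM.d_nonneg hM.d_self fun q => (hM.c_pos q).le, insert_empty_eq,
    sub_zero] at h2
  nlinarith [loss_empty_sub_loss_singleton_pos hM q]

/-- The number `β = κ / (1 - κ)`, for the curvature `κ`. -/
noncomputable def curvatureRatio (p c : Fin m → ℝ) (d : Fin m → Fin m → ℝ) : ℝ :=
  curvature p c d / (1 - curvature p c d)

lemma approxRatio_eq (p c : Fin m → ℝ) (d : Fin m → Fin m → ℝ) :
    approxRatio p c d = expRatio (curvatureRatio p c d) := rfl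

lemma curvatureRatio_nonneg {p c : Fin m → ℝ} {d : Fin m → Fin m → ℝ} (hM : IsModel p c d)
    (hκ : curvature p c d < 1) : 0 ≤ curvatureRatio p c d :=
  div_nonneg (curvature_nonneg hM) (by linarith)

lemma one_add_half_le_approxRatio {p c : Fin m → ℝ} {d : Fin m → Fin m → ℝ} (hM : IsModel p c d)
    (hκ : curvature p c d < 1) : 1 + curvatureRatio p c d / 2 ≤ approxRatio p c d :=
  one_add_half_le_expRatio (curvatureRatio_nonneg hM hκ)

lemma uncachedLoss_insert_sub_le {p c : Fin m → ℝ} {d : Fin m → Fin m → ℝ} (hM : IsModel p c d)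
    (hκ : curvature p c d < 1) {Y : Finset (Fin m)} {y : Fin m} (hy : y ∉ Y) :
    uncachedLoss p c d (insert y Y) - uncachedLoss p c d Y ≤
      (1 + curvatureRatio p c d) * uncachedLoss p c d {y} := by
  have h1 := uncachedLoss_marginal_le hM hy
  have h2 := one_sub_curvature_mul_le hM y
  have h3 : 0 < 1 - curvature p c d := by linarith
  have h4 : 1 + curvatureRatio p c d = 1 / (1 - curvature p c d) := by
    unfold curvatureRatio; field_simp; ring
  refine h1.trans ?_
  rw [h4, one_div, inv_mul_eq_div, le_div_iff₀ h3]
  linarith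

/-! ### Reverse greedy with estimated parameters -/

/-- The queries that reverse greedy with parameters `p`, `c` has removed after `i` steps. -/
noncomputable def removed (R : ArgminRule m) (p c : Fin m → ℝ) (d : Fin m → Fin m → ℝ) (i : ℕ) :
    Finset (Fin m) :=
  ((fun S : Finset (Fin m) => S.erase (R.pick S fun q => loss p c d (S.erase q)))^[i]
    Finset.univ)ᶜ

/-- Reverse greedy run with frequencies `p'` and optimistic costs `c'`. The error of `c'` only
counts for the queries that would be sent to the LLM: for the others the optimistic cost already
exceeds the distance to the cache, and does so for every larger cache. -/
theorem loss_reverseGreedy_le {p c : Fin m → ℝ} {d : Fin m → Fin m → ℝ} (hM : IsModel p c d)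
    (hκ : curvature p c d < 1) (R : ArgminRule m) (k : ℕ) {p' c' V : Fin m → ℝ}
    (hp' : ∀ q, 0 ≤ p' q) (hc' : ∀ q, c' q ≤ c q) (hV0 : ∀ q, 0 ≤ V q)
    (hV : ∀ q, (c' q : WithTop ℝ) < distTo d q (reverseGreedy R k p' c' d) →
      c q - max (c' q) 0 ≤ V q) {e : ℝ} (he : ∑ q, |p' q - p q| ≤ e) :
    loss p c d (reverseGreedy R k p' c' d) ≤
      approxRatio p c d * (optLoss k p c d + e + (1 + curvatureRatio p c d) * (e + ∑ q, p q * V q))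
        + (e + ∑ q, p q * V q) := by
  classical
  set c₀ : Fin m → ℝ := fun q => max (c' q) 0 with hc₀
  have hc₀0 : ∀ q, 0 ≤ c₀ q := fun q => le_max_right _ _
  have hc₀c : ∀ q, c₀ q ≤ c q := fun q => max_le (hc' q) (hM.c_pos q).le
  have hc₀1 : ∀ q, c₀ q ≤ 1 := fun q => (hc₀c q).trans (hM.c_le_one q)
  have hp : ∀ q, 0 ≤ p q := fun q => (hM.p_pos q).le
  have he0 : 0 ≤ e := (Finset.sum_nonneg fun q _ => abs_nonneg _).trans he
  set W : ℝ := ∑ q, p q * V q with hW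
  have hW0 : 0 ≤ W := Finset.sum_nonneg fun q _ => mul_nonneg (hp q) (hV0 q)
  set r := m - k with hr
  set Y : ℕ → Finset (Fin m) := removed R p' c' d with hY
  set y : ℕ → Fin m := fun i => R.pick (Y i)ᶜ fun q => loss p' c' d ((Y i)ᶜ.erase q) with hy
  have hYr : (Y r)ᶜ = reverseGreedy R k p' c' d := by
    simp [hY, removed, reverseGreedy, hr]
  have hYs : ∀ i, Y (i + 1) = insert (y i) (Y i) := fun i => by
    simp only [hY, hy, removed, Function.iterate_succ_apply', compl_compl, Finset.compl_erase]
  have hne : ∀ i < r, (Y i)ᶜ.Nonempty := by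
    have hcard : ∀ i, (Y i).card ≤ i := by
      intro i
      induction i with
      | zero => simp [hY, removed]
      | succ i ih => rw [hYs]; exact (Finset.card_insert_le _ _).trans (by omega)
    intro i hi
    rw [← Finset.card_pos, Finset.card_compl, Fintype.card_fin]
    have := hcard i
    omega
  -- an optimal cache may be assumed to be as large as possible
  obtain ⟨Z, hZ, hZo⟩ : ∃ Z : Finset (Fin m),
      Z.card = r ∧ uncachedLoss p c d Z ≤ optLoss k p c d := by
    obtain ⟨M, hMk, hMo⟩ := Finset.exists_mem_eq_inf'
      (s := Finset.univ.filter fun M : Finset (Fin m) => M.card ≤ k) ⟨∅, by simp⟩ (loss p c d)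
    have hMk' : M.card ≤ k := (Finset.mem_filter.1 hMk).2
    have hMm : M.card ≤ m := by simpa using Finset.card_le_univ M
    obtain ⟨M', hMM', -, hM'⟩ := Finset.exists_subsuperset_card_eq (Finset.subset_univ M)
      (n := min k m) (le_min hMk' hMm) (by simp)
    refine ⟨M'ᶜ, ?_, ?_⟩
    · rw [Finset.card_compl, hM', Fintype.card_fin]; omega
    · rw [uncachedLoss, compl_compl]
      exact (loss_anti hp c d hMM').trans hMo.ge
  have key := greedy_le (g := uncachedLoss p c d) (h := uncachedLoss p' c₀ d)
    (curvatureRatio_nonneg hM hκ) he0 (add_nonneg he0 hW0)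
    (uncachedLoss_empty hM.d_nonneg hM.d_self fun q => (hM.c_pos q).le)
    (uncachedLoss_empty hM.d_nonneg hM.d_self hc₀0)
    (fun X => hM.loss_nonneg _)
    (fun X x => loss_anti hp' _ _ (Finset.compl_subset_compl.2 (Finset.subset_insert _ _)))
    (isSupermodular_uncachedLoss hp c d) (isSupermodular_uncachedLoss hp' c₀ d)
    (fun X x hx => uncachedLoss_insert_sub_le hM hκ hx) r Y y (by simp [hY, removed])
    (fun i _ => hYs i)
    (fun i hi => Finset.mem_compl.1 (R.pick_mem _ _ (hne i hi)))
    (fun i hi z hz => by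
      have h := R.pick_le (Y i)ᶜ (fun q => loss p' c' d ((Y i)ᶜ.erase q)) z (by simpa using hz)
      simp only [loss_eq_pos_part p' c' hM.d_nonneg, add_le_add_iff_right] at h
      rw [uncachedLoss, uncachedLoss, Finset.compl_insert, Finset.compl_insert]
      simp only [hy]
      convert h using 5
      simp only [loss_eq_pos_part p' c' hM.d_nonneg])
    (fun X => by
      refine (loss_sub_le (p' := p) hM.d_nonneg hc₀0 hc₀1 _).trans ?_
      refine add_le_add (Finset.sum_le_sum fun q _ =>
        mul_le_mul_of_nonneg_left (serveLoss_mono_cost (hc₀c q) _ _ _) (hp q)) ?_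
      simpa only [abs_sub_comm] using he)
    (fun X hX => by
      have h1 : loss p c d Xᶜ ≤ loss p c₀ d Xᶜ + W := by
        unfold loss
        rw [hW, ← Finset.sum_add_distrib]
        refine Finset.sum_le_sum fun q _ => ?_
        rw [← mul_add]
        refine mul_le_mul_of_nonneg_left ?_ (hp q)
        by_cases hq : (c' q : WithTop ℝ) < distTo d q (reverseGreedy R k p' c' d)
        · exact serveLoss_le_add (hV0 q) (by linarith [hV q hq]) _ _ _
        · rw [not_lt, ← hYr] at hq
          have h2 : distTo d q Xᶜ ≤ (c₀ q : WithTop ℝ) :=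
            ((Finset.inf_mono (Finset.compl_subset_compl.2 hX)).trans hq).trans
              (WithTop.coe_le_coe.2 (le_max_left _ _))
          exact (serveLoss_le_of_distTo_le h2).trans (by linarith [hV0 q])
      have h2 := loss_sub_le (p := p) (p' := p') hM.d_nonneg hc₀0 hc₀1 Xᶜ
      unfold uncachedLoss
      linarith)
    Z hZ
  have hα : 0 ≤ expRatio (curvatureRatio p c d) := by
    have h1 := one_add_half_le_expRatio (curvatureRatio_nonneg hM hκ)
    have h2 := curvatureRatio_nonneg hM hκ
    linarith
  rw [uncachedLoss, hYr] at key
  refine key.trans ?_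
  rw [approxRatio_eq]
  gcongr

/-! ### The number of stages -/

/-- The least number of observations in the first `j` stages, if a stage with `s` observations
before it has at least `1 + √(a s)` of them. -/
noncomputable def stageSeq (a : ℝ) : ℕ → ℝ
  | 0 => 0
  | j + 1 => stageSeq a j + 1 + Real.sqrt (a * stageSeq a j)

lemma stageSeq_nonneg (a : ℝ) (j : ℕ) : 0 ≤ stageSeq a j := by
  induction j with
  | zero => exact le_rfl
  | succ j ih => rw [stageSeq]; positivity

/-- A bound for the number of stages until a constant fraction of the horizon is reached. -/
noncomputable def stageBound (T : ℕ) : ℝ := 2 + 2 * Real.log (Real.log T)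

lemma stageSeq_ge_exp {a : ℝ} (ha : 0 < a) {T : ℕ} (haT : a ≤ T) (i : ℕ) :
    a * Real.exp (-(Real.log T / 2 ^ i)) ≤ stageSeq a (i + 1) := by
  have hT : (0 : ℝ) < T := ha.trans_le haT
  induction i with
  | zero =>
    rw [pow_zero, div_one, Real.exp_neg, Real.exp_log hT, ← div_eq_mul_inv]
    simp only [stageSeq, mul_zero, Real.sqrt_zero]
    rw [div_le_iff₀ hT]
    linarith
  | succ i ih =>
    rw [stageSeq]
    have h1 : a * Real.exp (-(Real.log T / 2 ^ (i + 1))) ≤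
        Real.sqrt (a * stageSeq a (i + 1)) := by
      apply Real.le_sqrt_of_sq_le
      have h2 : (Real.exp (-(Real.log T / 2 ^ (i + 1)))) ^ 2 = Real.exp (-(Real.log T / 2 ^ i)) := by
        rw [← Real.exp_nat_mul]
        congr 1
        push_cast
        rw [pow_succ]
        field_simp
      rw [mul_pow, h2, sq, mul_assoc]
      exact mul_le_mul_of_nonneg_left ih ha.le
    have := stageSeq_nonneg a (i + 1)
    linarith

/-- Until `a / e` observations are reached, a stage at least takes the square root of the fraction
of `a` that is reached, which happens `log log T` times. After that, `√(s / a)` grows by a constant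
in every stage. -/
lemma stage_count_le {a : ℝ} (ha : 0 < a) {T : ℕ} (hT : 3 ≤ T) (haT : a ≤ T) (j : ℕ) :
    (j : ℝ) ≤ stageBound T + 3 * Real.sqrt (stageSeq a j / a) := by
  have hlogT : 1 < Real.log T := by
    rw [Real.lt_log_iff_exp_lt (by positivity)]
    have : (3 : ℝ) ≤ T := by exact_mod_cast hT
    linarith [Real.exp_one_lt_d9]
  have hll : 0 < Real.log (Real.log T) := Real.log_pos hlogT
  set i₀ : ℕ := ⌈2 * Real.log (Real.log T)⌉₊ with hi₀
  have hi₀le : (i₀ : ℝ) ≤ 2 * Real.log (Real.log T) + 1 := (Nat.ceil_lt_add_one (by positivity)).le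
  -- the factor `2` replaces `1 / log 2`
  have hpow : Real.log T ≤ 2 ^ i₀ := by
    rw [← Real.log_le_log_iff (by linarith) (by positivity), Real.log_pow]
    have h1 : 2 * Real.log (Real.log T) ≤ i₀ := Nat.le_ceil _
    have h2 := Real.log_two_gt_d9
    nlinarith
  -- from stage `i₀ + 1` on, at least `a / e` observations have been made
  have hgrow : ∀ i : ℕ, 1 / 3 + (i : ℝ) / 3 ≤ Real.sqrt (stageSeq a (i₀ + 1 + i) / a) := by
    intro i
    induction i with
    | zero =>
      apply Real.le_sqrt_of_sq_le
      rw [le_div_iff₀ ha]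
      refine le_trans ?_ (stageSeq_ge_exp ha haT i₀)
      rw [mul_comm]
      refine mul_le_mul_of_nonneg_left ?_ ha.le
      have h1 : Real.log T / 2 ^ i₀ ≤ 1 := div_le_one_of_le₀ hpow (by positivity)
      have h2 : Real.exp (-1) ≤ Real.exp (-(Real.log T / 2 ^ i₀)) := Real.exp_le_exp.2 (by linarith)
      have h3 := Real.exp_neg_one_gt_d9
      norm_num at h3 ⊢
      linarith
    | succ i ih =>
      set u := stageSeq a (i₀ + 1 + i) / a with hu
      have hu0 : 0 ≤ u := div_nonneg (stageSeq_nonneg _ _) ha.le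
      have hs : u + Real.sqrt u ≤ stageSeq a (i₀ + 1 + (i + 1)) / a := by
        rw [← add_assoc, stageSeq, le_div_iff₀ ha]
        have h1 : stageSeq a (i₀ + 1 + i) = a * u := by rw [hu]; field_simp
        have h2 : Real.sqrt (a * (a * u)) = a * Real.sqrt u := by
          rw [← mul_assoc, Real.sqrt_mul (by positivity), Real.sqrt_mul_self ha.le]
        rw [h1, h2]
        linarith
      refine le_trans ?_ (Real.sqrt_le_sqrt hs)
      apply Real.le_sqrt_of_sq_le
      have hsq := Real.sq_sqrt hu0
      have h3 : (1 : ℝ) / 3 ≤ Real.sqrt u := le_trans (by simp; positivity) ih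
      have h4 : 1 / 3 + ((i + 1 : ℕ) : ℝ) / 3 ≤ Real.sqrt u + 1 / 3 := by push_cast; linarith
      have h5 : (1 / 3 + ((i + 1 : ℕ) : ℝ) / 3) ^ 2 ≤ (Real.sqrt u + 1 / 3) ^ 2 :=
        pow_le_pow_left₀ (by positivity) h4 2
      nlinarith
  unfold stageBound
  rcases le_or_gt j (i₀ + 1) with hj | hj
  · have h1 : (j : ℝ) ≤ i₀ + 1 := by exact_mod_cast hj
    have := Real.sqrt_nonneg (stageSeq a j / a)
    linarith
  · obtain ⟨i, rfl⟩ := Nat.exists_eq_add_of_lt hj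
    have h1 := hgrow (i + 1)
    rw [← add_assoc] at h1
    push_cast at h1 ⊢
    linarith

/-- An upper bound for the estimation error in a stage with `s` observations before it. -/
noncomputable def stageWidth (b B : ℝ) (s : ℕ) : ℝ := if s = 0 then b else min b (Real.sqrt (B / s))

lemma stageWidth_nonneg {b : ℝ} (hb : 0 ≤ b) (B : ℝ) (s : ℕ) : 0 ≤ stageWidth b B s := by
  unfold stageWidth; split_ifs <;> positivity

lemma stageWidth_le {b : ℝ} (B : ℝ) (s : ℕ) : stageWidth b B s ≤ b := by
  unfold stageWidth; split_ifs <;> simp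

/-- The errors of a stage sum up to at most a bound that is the same for all stages. -/
lemma mul_stageWidth_le {b B x r : ℝ} (hb : 0 ≤ b) (hx : 0 ≤ x) {s : ℕ}
    (hr : r ≤ 2 + Real.sqrt (x * s)) : r * stageWidth b B s ≤ 2 * b + Real.sqrt (x * B) := by
  have hw := stageWidth_nonneg hb B s
  refine (mul_le_mul_of_nonneg_right hr hw).trans ?_
  rw [add_mul]
  refine add_le_add (mul_le_mul_of_nonneg_left (stageWidth_le B s) (by norm_num)) ?_
  rcases Nat.eq_zero_or_pos s with rfl | hs
  · simp
  · have h1 : stageWidth b B s ≤ Real.sqrt (B / s) := by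
      unfold stageWidth; rw [if_neg hs.ne']; exact min_le_right _ _
    have hs' : (0 : ℝ) < s := by exact_mod_cast hs
    refine (mul_le_mul_of_nonneg_left h1 (Real.sqrt_nonneg _)).trans (le_of_eq ?_)
    rw [← Real.sqrt_mul (by positivity)]
    congr 1
    field_simp

/-! ### The dynamics of the algorithm -/

namespace State

/-- In state `s`, the LLM is called for the query `q`. -/
def Observes (d : Fin m → Fin m → ℝ) (s : State m) (q : Fin m) : Prop :=
  (s.lcb q : WithTop ℝ) < distTo d q s.cache

variable (R : ArgminRule m) (k T t : ℕ) (d : Fin m → Fin m → ℝ) (s : State m) (q : Fin m) (y : ℝ)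

@[simp] lemma maybeSwitch_obs : (s.maybeSwitch R k T t d).obs = s.obs := by
  unfold maybeSwitch; split_ifs <;> rfl

@[simp] lemma maybeSwitch_costSum : (s.maybeSwitch R k T t d).costSum = s.costSum := by
  unfold maybeSwitch; split_ifs <;> rfl

@[simp] lemma maybeSwitch_arrivals : (s.maybeSwitch R k T t d).arrivals = s.arrivals := by
  unfold maybeSwitch; split_ifs <;> rfl

open Classical in
lemma maybeSwitch_cur : (s.maybeSwitch R k T t d).cur q =
    if s.QueryTrigger T q then 0 else s.cur q := by
  unfold maybeSwitch
  split_ifs with h1 h2 h3 h4 h5 <;> first | rfl | simp_all [newQueryStage, switchCache]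

open Classical in
lemma maybeSwitch_past : (s.maybeSwitch R k T t d).past q =
    if s.QueryTrigger T q then s.past q + s.cur q else s.past q := by
  unfold maybeSwitch
  split_ifs with h1 h2 h3 h4 h5 <;> first | rfl | simp_all [newQueryStage, switchCache]

variable {T s} in
lemma maybeSwitch_of_query (h : ∃ q, s.QueryTrigger T q) :
    s.maybeSwitch R k T t d = (s.newQueryStage T).switchCache R k T t d := if_pos h

variable {T s} in
lemma maybeSwitch_of_arrival (h : ¬ ∃ q, s.QueryTrigger T q) (h' : s.ArrivalTrigger T) :
    s.maybeSwitch R k T t d = s.newArrivalStage.switchCache R k T t d := by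
  unfold maybeSwitch; rw [if_neg h, if_pos h']

variable {T s} in
lemma maybeSwitch_of_not (h : ¬ ∃ q, s.QueryTrigger T q) (h' : ¬ s.ArrivalTrigger T) :
    s.maybeSwitch R k T t d = s := by
  unfold maybeSwitch; rw [if_neg h, if_neg h']

@[simp] lemma serve_cache : (s.serve d q y).cache = s.cache := by
  unfold serve; dsimp only; split_ifs <;> rfl

@[simp] lemma serve_lcb : (s.serve d q y).lcb = s.lcb := by
  unfold serve; dsimp only; split_ifs <;> rfl

@[simp] lemma serve_past : (s.serve d q y).past = s.past := by
  unfold serve; dsimp only; split_ifs <;> rfl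

@[simp] lemma serve_pastP : (s.serve d q y).pastP = s.pastP := by
  unfold serve; dsimp only; split_ifs <;> rfl

@[simp] lemma serve_curP : (s.serve d q y).curP = s.curP + 1 := by
  unfold serve; dsimp only; split_ifs <;> rfl

@[simp] lemma serve_arrivals :
    (s.serve d q y).arrivals = Function.update s.arrivals q (s.arrivals q + 1) := by
  unfold serve; dsimp only; split_ifs <;> rfl

open Classical in
lemma serve_obs (u : Fin m) : (s.serve d q y).obs u =
    s.obs u + if q = u ∧ s.Observes d u then 1 else 0 := by
  unfold serve Observes
  dsimp only
  by_cases h2 : (s.lcb q : WithTop ℝ) < distTo d q s.cache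
  · rw [if_pos h2]
    by_cases h : q = u
    · subst h; simp [h2]
    · simp [h, Function.update_of_ne (Ne.symm h)]
  · rw [if_neg h2, if_neg (by rintro ⟨rfl, h⟩; exact h2 h), add_zero]

open Classical in
lemma serve_cur (u : Fin m) : (s.serve d q y).cur u =
    s.cur u + if q = u ∧ s.Observes d u then 1 else 0 := by
  unfold serve Observes
  dsimp only
  by_cases h2 : (s.lcb q : WithTop ℝ) < distTo d q s.cache
  · rw [if_pos h2]
    by_cases h : q = u
    · subst h; simp [h2]
    · simp [h, Function.update_of_ne (Ne.symm h)]
  · rw [if_neg h2, if_neg (by rintro ⟨rfl, h⟩; exact h2 h), add_zero]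

open Classical in
lemma serve_costSum (u : Fin m) : (s.serve d q y).costSum u =
    s.costSum u + if q = u ∧ s.Observes d u then y else 0 := by
  unfold serve Observes
  dsimp only
  by_cases h2 : (s.lcb q : WithTop ℝ) < distTo d q s.cache
  · rw [if_pos h2]
    by_cases h : q = u
    · subst h; simp [h2]
    · simp [h, Function.update_of_ne (Ne.symm h)]
  · rw [if_neg h2, if_neg (by rintro ⟨rfl, h⟩; exact h2 h), add_zero]

end State

section Dynamics

variable (R : ArgminRule m) (k T : ℕ) (d : Fin m → Fin m → ℝ) (query : ℕ → Fin m)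
  (cost : ℕ → Fin m → ℝ)

/-- The state in round `t + 1` between the cache switch and the arrival of the query. -/
noncomputable def midState (t : ℕ) : State m :=
  (run R k T d query cost t).maybeSwitch R k T (t + 1) d

lemma run_succ (t : ℕ) : run R k T d query cost (t + 1) =
    (midState R k T d query cost t).serve d (query (t + 1)) (cost (t + 1) (query (t + 1))) := rfl

open Classical in
/-- The number of completed stages of `q` in the first `t` rounds. -/
noncomputable def queryStages (q : Fin m) (t : ℕ) : ℕ :=
  ∑ s ∈ Finset.range t, if (run R k T d query cost s).QueryTrigger T q then 1 else 0

open Classical in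
/-- The number of completed stages of the arrivals in the first `t` rounds. -/
noncomputable def arrivalStages (t : ℕ) : ℕ :=
  ∑ s ∈ Finset.range t, if (¬ ∃ q, (run R k T d query cost s).QueryTrigger T q) ∧
    (run R k T d query cost s).ArrivalTrigger T then 1 else 0

lemma obs_eq (t : ℕ) (q : Fin m) : (run R k T d query cost t).obs q =
    (run R k T d query cost t).past q + (run R k T d query cost t).cur q := by
  induction t with
  | zero => rfl
  | succ t ih =>
    rw [run_succ, State.serve_obs, State.serve_past, State.serve_cur, midState,
      State.maybeSwitch_obs, State.maybeSwitch_past, State.maybeSwitch_cur, ih]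
    split_ifs <;> omega

lemma midState_past_le (t : ℕ) (q : Fin m) :
    (midState R k T d query cost t).past q ≤ (run R k T d query cost t).obs q := by
  rw [midState, State.maybeSwitch_past, obs_eq]
  split_ifs <;> omega

lemma sum_obs_le (t : ℕ) : ∑ q, (run R k T d query cost t).obs q ≤ t := by
  induction t with
  | zero => simp [run, State.init]
  | succ t ih =>
    classical
    rw [run_succ]
    simp only [State.serve_obs, midState, State.maybeSwitch_obs, Finset.sum_add_distrib]
    refine add_le_add ih ?_
    refine (Finset.sum_le_sum fun q _ => show (if _ ∧ _ then 1 else 0) ≤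
      if query (t + 1) = q then 1 else 0 from ?_).trans (by simp)
    split_ifs <;> simp_all

lemma sum_arrivals (t : ℕ) : ∑ q, (run R k T d query cost t).arrivals q = t := by
  induction t with
  | zero => simp [run, State.init]
  | succ t ih =>
    rw [run_succ, State.serve_arrivals, midState, State.maybeSwitch_arrivals,
      Finset.sum_update_of_mem (Finset.mem_univ _),
      ← Finset.add_sum_erase _ _ (Finset.mem_univ (query (t + 1)))] at *
    rw [Finset.sdiff_singleton_eq_erase]
    omega

lemma pastP_add_curP (t : ℕ) :
    (run R k T d query cost t).pastP + (run R k T d query cost t).curP = t := by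
  induction t with
  | zero => rfl
  | succ t ih =>
    rw [run_succ, State.serve_pastP, State.serve_curP, midState]
    by_cases h : ∃ q, (run R k T d query cost t).QueryTrigger T q
    · rw [State.maybeSwitch_of_query _ _ _ _ h]
      simp only [State.switchCache, State.newQueryStage]; omega
    by_cases h' : (run R k T d query cost t).ArrivalTrigger T
    · rw [State.maybeSwitch_of_arrival _ _ _ _ h h']
      simp only [State.switchCache, State.newArrivalStage]; omega
    · rw [State.maybeSwitch_of_not _ _ _ _ h h']; omega

/-- A stage stops as soon as its planned length is reached. -/
lemma cur_le (t : ℕ) (q : Fin m) : ((run R k T d query cost t).cur q : ℝ) ≤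
    2 + Real.sqrt ((T : ℝ) / m * ((run R k T d query cost t).past q : ℝ)) := by
  cases t with
  | zero => simp only [run, State.init]; push_cast; positivity
  | succ t =>
    rw [run_succ, State.serve_cur, State.serve_past]
    set s := run R k T d query cost t
    have h1 : ((midState R k T d query cost t).cur q : ℝ) ≤
        1 + Real.sqrt ((T : ℝ) / m * (midState R k T d query cost t).past q) := by
      rw [midState, State.maybeSwitch_cur, State.maybeSwitch_past]
      split_ifs with h
      · push_cast; positivity
      · unfold State.QueryTrigger at h
        rw [not_le, mul_div_right_comm] at h
        exact h.le
    push_cast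
    split_ifs <;> linarith

lemma stageSeq_le_of_le {a : ℝ} (ha : 0 ≤ a) {j s n : ℕ} (h : stageSeq a j ≤ s)
    (hn : 1 + Real.sqrt (a * s) ≤ n) : stageSeq a (j + 1) ≤ (s + n : ℕ) := by
  rw [stageSeq]
  have : Real.sqrt (a * stageSeq a j) ≤ Real.sqrt (a * s) := by gcongr
  push_cast
  linarith

lemma stageSeq_queryStages_le (t : ℕ) (q : Fin m) :
    stageSeq ((T : ℝ) / m) (queryStages R k T d query cost q t) ≤
      (run R k T d query cost t).past q := by
  induction t with
  | zero => simp [queryStages, run, State.init, stageSeq]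
  | succ t ih =>
    rw [run_succ, State.serve_past, midState, State.maybeSwitch_past, queryStages,
      Finset.sum_range_succ, ← queryStages]
    split_ifs with h
    · refine stageSeq_le_of_le (by positivity) ih ?_
      rw [← mul_div_right_comm]
      exact h
    · exact ih

lemma stageSeq_arrivalStages_le (t : ℕ) :
    stageSeq T (arrivalStages R k T d query cost t) ≤ (run R k T d query cost t).pastP := by
  induction t with
  | zero => simp [arrivalStages, run, State.init, stageSeq]
  | succ t ih =>
    rw [run_succ, State.serve_pastP, midState, arrivalStages,
      Finset.sum_range_succ, ← arrivalStages]
    by_cases h : ∃ q, (run R k T d query cost t).QueryTrigger T q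
    · rw [State.maybeSwitch_of_query _ _ _ _ h, if_neg (by tauto)]
      exact ih
    by_cases h' : (run R k T d query cost t).ArrivalTrigger T
    · rw [State.maybeSwitch_of_arrival _ _ _ _ h h', if_pos ⟨h, h'⟩]
      exact stageSeq_le_of_le (by positivity) ih h'
    · rw [State.maybeSwitch_of_not _ _ _ _ h h', if_neg (by tauto)]
      exact ih

lemma arrivalStages_le (hT : 3 ≤ T) :
    (arrivalStages R k T d query cost T : ℝ) ≤ stageBound T + 3 := by
  have hT0 : (0 : ℝ) < T := by positivity
  refine (stage_count_le hT0 hT le_rfl _).trans ?_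
  have h1 := stageSeq_arrivalStages_le R k T d query cost T
  have h2 : ((run R k T d query cost T).pastP : ℝ) ≤ T := by
    exact_mod_cast (Nat.le_add_right _ _).trans (pastP_add_curP R k T d query cost T).le
  have h3 : Real.sqrt (stageSeq T (arrivalStages R k T d query cost T) / T) ≤ 1 :=
    Real.sqrt_le_one.2 (div_le_one_of_le₀ (h1.trans h2) hT0.le)
  linarith

lemma sum_queryStages_le (hm : 0 < m) (hT : 3 ≤ T) :
    (∑ q, (queryStages R k T d query cost q T : ℝ)) ≤ m * (stageBound T + 3) := by
  have hT0 : (0 : ℝ) < T := by positivity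
  have hm0 : (0 : ℝ) < m := by positivity
  have ha : (0 : ℝ) < T / m := by positivity
  have haT : (T : ℝ) / m ≤ T := div_le_self hT0.le (by exact_mod_cast hm)
  set x : Fin m → ℝ := fun q => Real.sqrt ((run R k T d query cost T).past q / ((T : ℝ) / m)) with hx
  have h1 : ∀ q, (queryStages R k T d query cost q T : ℝ) ≤ stageBound T + 3 * x q := fun q => by
    refine (stage_count_le ha hT haT _).trans ?_
    have := Real.sqrt_le_sqrt (div_le_div_of_nonneg_right
      (stageSeq_queryStages_le R k T d query cost T q) ha.le)
    simp only [hx]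
    linarith
  -- Cauchy-Schwarz, as the numbers of observations sum up to at most `T`
  have h2 : ∑ q, x q ^ 2 ≤ m := by
    have h3 : ∀ q, x q ^ 2 = (run R k T d query cost T).past q * (m / T) := fun q => by
      simp only [hx]
      rw [Real.sq_sqrt (by positivity)]
      field_simp
    simp only [h3, ← Finset.sum_mul]
    have h4 : (∑ q, ((run R k T d query cost T).past q : ℝ)) ≤ T := by
      have h5 : ∑ q, (run R k T d query cost T).past q ≤ T :=
        (Finset.sum_le_sum fun q _ => by rw [obs_eq]; omega).trans (sum_obs_le R k T d query cost T)
      exact_mod_cast h5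
    calc _ ≤ (T : ℝ) * (m / T) := by gcongr
      _ = m := by field_simp
  have h6 : ∑ q, x q ≤ m := by
    have h7 := sq_sum_le_card_mul_sum_sq (s := Finset.univ) (f := x)
    simp only [Finset.card_univ, Fintype.card_fin] at h7
    have h8 : (∑ q, x q) ^ 2 ≤ (m : ℝ) ^ 2 := by nlinarith
    exact (le_abs_self _).trans (abs_le_of_sq_le_sq h8 hm0.le)
  refine (Finset.sum_le_sum fun q _ => h1 q).trans ?_
  rw [Finset.sum_add_distrib, ← Finset.mul_sum]
  simp
  linarith

/-- The total width of the confidence intervals of `q` in the rounds in which its cost is observed. -/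
lemma sum_stageWidth_observed_le {B : ℝ} (t : ℕ) (q : Fin m) :
    open Classical in
    ∑ s ∈ Finset.range t, (if query (s + 1) = q ∧ (midState R k T d query cost s).Observes d q then
      stageWidth 1 B ((midState R k T d query cost s).past q) else 0) ≤
    queryStages R k T d query cost q t * (2 + Real.sqrt (T / m * B)) +
      (run R k T d query cost t).cur q * stageWidth 1 B ((run R k T d query cost t).past q) := by
  classical
  induction t with
  | zero => simp [queryStages, run, State.init]
  | succ t ih =>
    rw [Finset.sum_range_succ, run_succ, State.serve_cur, State.serve_past, queryStages,
      Finset.sum_range_succ, ← queryStages]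
    have h1 := mul_stageWidth_le (B := B) zero_le_one (by positivity)
      (cur_le R k T d query cost t q)
    rw [mul_one] at h1
    have h2 : ∑ s ∈ Finset.range t, (if query (s + 1) = q ∧
          (midState R k T d query cost s).Observes d q then
          stageWidth 1 B ((midState R k T d query cost s).past q) else 0) ≤
        ((queryStages R k T d query cost q t + if (run R k T d query cost t).QueryTrigger T q
          then 1 else 0 : ℕ) : ℝ) * (2 + Real.sqrt (T / m * B)) +
        (midState R k T d query cost t).cur q *
          stageWidth 1 B ((midState R k T d query cost t).past q) := by
      rw [midState, State.maybeSwitch_cur, State.maybeSwitch_past]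
      split_ifs with h
      · push_cast; linarith
      · push_cast; linarith
    split_ifs <;> push_cast at * <;> simp_all <;> linarith

lemma sum_sum_stageWidth_observed_le (hm : 0 < m) (hT : 3 ≤ T) {B : ℝ} :
    open Classical in
    ∑ s ∈ Finset.range T, ∑ q, (if query (s + 1) = q ∧
      (midState R k T d query cost s).Observes d q then
      stageWidth 1 B ((midState R k T d query cost s).past q) else 0) ≤
    m * (stageBound T + 4) * (2 + Real.sqrt (T / m * B)) := by
  classical
  rw [Finset.sum_comm]
  have h1 : ∀ q, ∑ s ∈ Finset.range T, (if query (s + 1) = q ∧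
      (midState R k T d query cost s).Observes d q then
      stageWidth 1 B ((midState R k T d query cost s).past q) else 0) ≤
      ((queryStages R k T d query cost q T : ℝ) + 1) * (2 + Real.sqrt (T / m * B)) := fun q => by
    have h2 := sum_stageWidth_observed_le R k T d query cost (B := B) T q
    have h3 := mul_stageWidth_le (B := B) zero_le_one (by positivity)
      (cur_le R k T d query cost T q)
    linarith
  refine (Finset.sum_le_sum fun q _ => h1 q).trans ?_
  rw [← Finset.sum_mul]
  refine mul_le_mul_of_nonneg_right ?_ (by positivity)
  rw [Finset.sum_add_distrib]
  have := sum_queryStages_le R k T d query cost hm hT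
  simp
  linarith

open Classical in
/-- The number of cache switches due to stages of queries is at most the number of these stages. -/
lemma card_query_switch_le (t : ℕ) :
    ∑ s ∈ Finset.range t, (if ∃ q, (run R k T d query cost s).QueryTrigger T q then (1 : ℝ) else 0) ≤
      ∑ q, (queryStages R k T d query cost q t : ℝ) := by
  simp only [queryStages, Nat.cast_sum]
  rw [Finset.sum_comm]
  refine Finset.sum_le_sum fun s _ => ?_
  split_ifs with h
  · obtain ⟨q, hq⟩ := h
    refine le_trans ?_ (Finset.single_le_sum (fun i _ => by positivity) (Finset.mem_univ q))
    simp [hq]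
  · positivity

/-- The total estimation error of the arrival probabilities. Here `r` counts the rounds of the current
stage without a switch due to a stage of a query. A stage of arrivals whose end is delayed by such
switches can be longer than planned; the rounds with these switches are counted separately, with
the trivial bound `2`. -/
lemma sum_stageWidth_arrival_le {B : ℝ} (t : ℕ) :
    open Classical in
    ∃ r : ℝ, 0 ≤ r ∧ r ≤ (run R k T d query cost t).curP ∧
      r ≤ 2 + Real.sqrt (T * (run R k T d query cost t).pastP) ∧
      ∑ s ∈ Finset.range t, stageWidth 2 B (midState R k T d query cost s).pastP ≤
        2 * ∑ s ∈ Finset.range t,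
          (if ∃ q, (run R k T d query cost s).QueryTrigger T q then (1 : ℝ) else 0) +
        arrivalStages R k T d query cost t * (4 + Real.sqrt (T * B)) +
        r * stageWidth 2 B (run R k T d query cost t).pastP := by
  classical
  induction t with
  | zero => exact ⟨0, le_rfl, by simp, by positivity, by simp [arrivalStages]⟩
  | succ t ih =>
    obtain ⟨r, hr0, hr1, hr2, hr⟩ := ih
    have hw := mul_stageWidth_le (b := 2) (B := B) zero_le_two (by positivity) hr2
    rw [run_succ, State.serve_pastP, State.serve_curP, midState, arrivalStages,
      Finset.sum_range_succ, Finset.sum_range_succ, Finset.sum_range_succ, ← arrivalStages, midState]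
    push_cast
    by_cases h : ∃ q, (run R k T d query cost t).QueryTrigger T q
    · rw [State.maybeSwitch_of_query _ _ _ _ h, if_pos h, if_neg (by tauto)]
      simp only [State.switchCache, State.newQueryStage]
      refine ⟨r, hr0, by linarith, hr2, ?_⟩
      have := stageWidth_le (b := 2) B (run R k T d query cost t).pastP
      linarith
    by_cases h' : (run R k T d query cost t).ArrivalTrigger T
    · rw [State.maybeSwitch_of_arrival _ _ _ _ h h', if_neg h, if_pos ⟨h, h'⟩]
      simp only [State.switchCache, State.newArrivalStage]
      refine ⟨1, zero_le_one, by simp, ?_, ?_⟩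
      · have := Real.sqrt_nonneg (T * ((run R k T d query cost t).pastP +
          (run R k T d query cost t).curP : ℕ))
        linarith
      · linarith
    · rw [State.maybeSwitch_of_not _ _ _ _ h h', if_neg h, if_neg (by tauto)]
      unfold State.ArrivalTrigger at h'
      rw [not_le] at h'
      refine ⟨r + 1, by linarith, by linarith, by linarith, ?_⟩
      linarith

lemma sum_stageWidth_arrival_le' (hm : 0 < m) (hT : 3 ≤ T) {B : ℝ} :
    ∑ s ∈ Finset.range T, stageWidth 2 B (midState R k T d query cost s).pastP ≤
      2 * (m * (stageBound T + 3)) + (stageBound T + 4) * (4 + Real.sqrt (T * B)) := by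
  obtain ⟨r, hr0, hr1, hr2, hr⟩ := sum_stageWidth_arrival_le R k T d query cost (B := B) T
  have hw := mul_stageWidth_le (b := 2) (B := B) zero_le_two (by positivity) hr2
  have h1 := (card_query_switch_le R k T d query cost T).trans
    (sum_queryStages_le R k T d query cost hm hT)
  have h2 := arrivalStages_le R k T d query cost hT
  have h3 : 0 ≤ 4 + Real.sqrt (T * B) := by positivity
  nlinarith [mul_le_mul_of_nonneg_right h2 h3]

lemma cacheAt_succ (t : ℕ) :
    cacheAt R k T d query cost (t + 1) = (midState R k T d query cost t).cache := by
  rw [cacheAt, run_succ, State.serve_cache]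

/-- The total switching cost. -/
lemma sum_switching_le {c : Fin m → ℝ} (hc : ∀ q, c q ≤ 1) (hc0 : ∀ q, 0 ≤ c q)
    (hm : 0 < m) (hT : 3 ≤ T) :
    ∑ t ∈ Finset.range T, ∑ q ∈ cacheAt R k T d query cost (t + 1) \ cacheAt R k T d query cost t,
      c q ≤ m * (m * (stageBound T + 3) + (stageBound T + 3)) := by
  classical
  have h1 : ∀ t, ∑ q ∈ cacheAt R k T d query cost (t + 1) \ cacheAt R k T d query cost t, c q ≤
      m * ((if ∃ q, (run R k T d query cost t).QueryTrigger T q then (1 : ℝ) else 0) +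
        ((if (¬ ∃ q, (run R k T d query cost t).QueryTrigger T q) ∧
          (run R k T d query cost t).ArrivalTrigger T then 1 else 0 : ℕ) : ℝ)) := fun t => by
    have hle : ∑ q ∈ cacheAt R k T d query cost (t + 1) \ cacheAt R k T d query cost t, c q ≤ m := by
      refine (Finset.sum_le_sum_of_subset_of_nonneg (Finset.subset_univ _)
        fun q _ _ => hc0 q).trans ((Finset.sum_le_sum fun q _ => hc q).trans (by simp))
    by_cases h : ∃ q, (run R k T d query cost t).QueryTrigger T q
    · rw [if_pos h, if_neg (by tauto)]
      simpa using hle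
    by_cases h' : (run R k T d query cost t).ArrivalTrigger T
    · rw [if_neg h, if_pos ⟨h, h'⟩]
      simpa using hle
    · rw [cacheAt_succ, midState, State.maybeSwitch_of_not _ _ _ _ h h', cacheAt, if_neg h,
        if_neg (by tauto)]
      simp
  refine (Finset.sum_le_sum fun t _ => h1 t).trans ?_
  rw [← Finset.mul_sum, Finset.sum_add_distrib, ← Nat.cast_sum, ← arrivalStages]
  have h2 := (card_query_switch_le R k T d query cost T).trans
    (sum_queryStages_le R k T d query cost hm hT)
  have h3 := arrivalStages_le R k T d query cost hT
  gcongr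

/-- The cache and the confidence bounds in use come from an earlier round, in which the current
stages had already begun. -/
lemma midState_snapshot (t : ℕ) :
    (midState R k T d query cost t).pastP = 0 ∧ (∀ q, (midState R k T d query cost t).past q = 0) ∧
        (midState R k T d query cost t).cache = ∅ ∨
      ∃ n ≤ t, (midState R k T d query cost t).lcb = (fun q => lowerBound m T
          ((run R k T d query cost n).obs q) ((run R k T d query cost n).costSum q)) ∧
        (midState R k T d query cost t).cache = reverseGreedy R k
          (fun q => ((run R k T d query cost n).arrivals q : ℝ) / ((n + 1 : ℕ) : ℝ))
          (midState R k T d query cost t).lcb d ∧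
        (midState R k T d query cost t).pastP ≤ n ∧
        ∀ q, (midState R k T d query cost t).past q ≤ (run R k T d query cost n).obs q := by
  have hpast := midState_past_le R k T d query cost
  have hP : ∀ t, (midState R k T d query cost t).pastP ≤ t := fun t => by
    have h1 := pastP_add_curP R k T d query cost (t + 1)
    rw [run_succ, State.serve_pastP, State.serve_curP] at h1
    omega
  by_cases h : ∃ q, (run R k T d query cost t).QueryTrigger T q
  · refine Or.inr ⟨t, le_rfl, ?_, ?_, hP t, hpast t⟩ <;>
    · rw [midState, State.maybeSwitch_of_query _ _ _ _ h]; rfl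
  by_cases h' : (run R k T d query cost t).ArrivalTrigger T
  · refine Or.inr ⟨t, le_rfl, ?_, ?_, hP t, hpast t⟩ <;>
    · rw [midState, State.maybeSwitch_of_arrival _ _ _ _ h h']; rfl
  rw [midState, State.maybeSwitch_of_not _ _ _ _ h h']
  cases t with
  | zero => exact Or.inl ⟨rfl, fun _ => rfl, rfl⟩
  | succ t =>
    rw [run_succ]
    simp only [State.serve_pastP, State.serve_past, State.serve_cache, State.serve_lcb]
    rcases midState_snapshot t with h1 | ⟨n, hn, h1⟩
    · exact Or.inl h1
    · exact Or.inr ⟨n, by omega, h1⟩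

end Dynamics

/-! ### Measurability -/

lemma measurable_of_countable_index {α β ι : Type*} {mα : MeasurableSpace α}
    {mβ : MeasurableSpace β} [MeasurableSpace ι] [Countable ι] [MeasurableSingletonClass ι]
    {f : α → ι} (hf : Measurable f) {g : ι → α → β} (hg : ∀ i, Measurable (g i)) :
    Measurable fun a => g (f a) a :=
  (measurable_from_prod_countable_left (f := fun x : α × ι => g x.2 x.1) hg).comp
    (measurable_id.prodMk hf)

namespace State

/-- The components of a state. -/
def toTuple (s : State m) : Finset (Fin m) × (Fin m → ℝ) × (Fin m → ℕ) × (Fin m → ℕ) ×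
    (Fin m → ℝ) × (Fin m → ℕ) × (Fin m → ℕ) × ℕ × ℕ :=
  (s.cache, s.lcb, s.arrivals, s.obs, s.costSum, s.cur, s.past, s.curP, s.pastP)

/-- The product of the σ-algebras of the components. -/
instance : MeasurableSpace (State m) := MeasurableSpace.comap toTuple inferInstance

lemma measurable_components {α : Type*} {mα : MeasurableSpace α} {f : α → State m}
    (hf : Measurable f) : (Measurable fun a => (f a).cache) ∧ (Measurable fun a => (f a).lcb) ∧
    (Measurable fun a => (f a).arrivals) ∧ (Measurable fun a => (f a).obs) ∧
    (Measurable fun a => (f a).costSum) ∧ (Measurable fun a => (f a).cur) ∧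
    (Measurable fun a => (f a).past) ∧ (Measurable fun a => (f a).curP) ∧
    Measurable fun a => (f a).pastP := by
  have h : Measurable fun a => (f a).toTuple := (comap_measurable _).comp hf
  exact ⟨h.fst, h.snd.fst, h.snd.snd.fst, h.snd.snd.snd.fst, h.snd.snd.snd.snd.fst,
    h.snd.snd.snd.snd.snd.fst, h.snd.snd.snd.snd.snd.snd.fst, h.snd.snd.snd.snd.snd.snd.snd.fst,
    h.snd.snd.snd.snd.snd.snd.snd.snd⟩

lemma measurable_of_components {α : Type*} {mα : MeasurableSpace α} {f : α → State m}
    (h1 : Measurable fun a => (f a).cache) (h2 : Measurable fun a => (f a).lcb)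
    (h3 : Measurable fun a => (f a).arrivals) (h4 : Measurable fun a => (f a).obs)
    (h5 : Measurable fun a => (f a).costSum) (h6 : Measurable fun a => (f a).cur)
    (h7 : Measurable fun a => (f a).past) (h8 : Measurable fun a => (f a).curP)
    (h9 : Measurable fun a => (f a).pastP) : Measurable f :=
  measurable_comap_iff.2 (h1.prodMk (h2.prodMk (h3.prodMk (h4.prodMk (h5.prodMk (h6.prodMk
    (h7.prodMk (h8.prodMk h9))))))))

end State

lemma measurable_coe_lt_distTo {α : Type*} {mα : MeasurableSpace α} {x : α → ℝ}
    (hx : Measurable x) (D : WithTop ℝ) : Measurable fun a => (x a : WithTop ℝ) < D := by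
  induction D using WithTop.recTopCoe with
  | top => simp
  | coe r =>
    simp only [WithTop.coe_lt_coe]
    exact measurableSet_setOfPred.1 (measurableSet_lt hx measurable_const)

lemma measurable_serveLoss (d : Fin m → Fin m → ℝ) (q : Fin m) (M : Finset (Fin m)) :
    Measurable fun x => serveLoss x d q M := by
  induction M using Finset.induction_on with
  | empty => simpa only [serveLoss_empty] using measurable_id'
  | insert u M _ ih => simpa only [serveLoss_insert] using ih.min measurable_const

lemma measurable_reverseGreedy {α : Type*} {mα : MeasurableSpace α} (R : ArgminRule m) (k : ℕ)
    (d : Fin m → Fin m → ℝ) {p c : α → Fin m → ℝ} (hp : Measurable p) (hc : Measurable c) :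
    Measurable fun a => reverseGreedy R k (p a) (c a) d := by
  unfold reverseGreedy
  generalize m - k = n
  induction n with
  | zero => simp
  | succ n ih =>
    simp only [Function.iterate_succ_apply']
    refine measurable_of_countable_index ih (g := fun S a =>
      S.erase (R.pick S fun q => loss (p a) (c a) d (S.erase q))) fun S => ?_
    have h1 : Measurable fun a => fun q => loss (p a) (c a) d (S.erase q) := by
      refine measurable_pi_lambda _ fun q => ?_
      unfold loss
      refine Finset.measurable_sum _ fun i _ => ?_
      exact (hp.eval).mul ((measurable_serveLoss d i _).comp (hc.eval))
    exact (measurable_of_countable fun i => S.erase i).comp ((R.measurable_pick S).comp h1)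

lemma measurable_lowerBound (m T : ℕ) {α : Type*} {mα : MeasurableSpace α} {n : α → ℕ} {s : α → ℝ}
    (hn : Measurable n) (hs : Measurable s) : Measurable fun a => lowerBound m T (n a) (s a) := by
  refine measurable_of_countable_index hn (g := fun n a => lowerBound m T n (s a)) fun n => ?_
  unfold lowerBound
  split_ifs
  · exact measurable_const
  · exact (hs.div_const _).sub_const _

namespace State

variable {α : Type*} {mα : MeasurableSpace α} {f : α → State m}

lemma measurable_queryTrigger (T : ℕ) (hf : Measurable f) (q : Fin m) :
    Measurable fun a => (f a).QueryTrigger T q := by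
  obtain ⟨-, -, -, -, -, h6, h7, -, -⟩ := measurable_components hf
  have hcur : Measurable fun a => ((f a).cur q : ℝ) :=
    (measurable_of_countable fun n : ℕ => (n : ℝ)).comp (h6.eval (a := q))
  have hpast : Measurable fun a => 1 + Real.sqrt ((T : ℝ) * ((f a).past q : ℝ) / (m : ℝ)) :=
    (measurable_of_countable fun n : ℕ => 1 + Real.sqrt ((T : ℝ) * (n : ℝ) / (m : ℝ))).comp
      (h7.eval (a := q))
  exact measurableSet_setOfPred.1 (measurableSet_le hpast hcur)

lemma measurable_arrivalTrigger (T : ℕ) (hf : Measurable f) :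
    Measurable fun a => (f a).ArrivalTrigger T := by
  obtain ⟨-, -, -, -, -, -, -, h8, h9⟩ := measurable_components hf
  have hcur : Measurable fun a => ((f a).curP : ℝ) :=
    (measurable_of_countable fun n : ℕ => (n : ℝ)).comp h8
  have hpast : Measurable fun a => 1 + Real.sqrt ((T : ℝ) * ((f a).pastP : ℝ)) :=
    (measurable_of_countable fun n : ℕ => 1 + Real.sqrt ((T : ℝ) * (n : ℝ))).comp h9
  exact measurableSet_setOfPred.1 (measurableSet_le hpast hcur)

lemma measurable_newQueryStage (T : ℕ) (hf : Measurable f) :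
    Measurable fun a => (f a).newQueryStage T := by
  obtain ⟨h1, h2, h3, h4, h5, h6, h7, h8, h9⟩ := measurable_components hf
  refine measurable_of_components h1 h2 h3 h4 h5
    (measurable_pi_lambda _ fun q => ?_) (measurable_pi_lambda _ fun q => ?_) h8 h9
  · exact Measurable.ite (measurableSet_setOfPred.2 (measurable_queryTrigger T hf q))
      measurable_const h6.eval
  · exact Measurable.ite (measurableSet_setOfPred.2 (measurable_queryTrigger T hf q))
      (h7.eval.add h6.eval) h7.eval

lemma measurable_newArrivalStage (hf : Measurable f) :
    Measurable fun a => (f a).newArrivalStage := by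
  obtain ⟨h1, h2, h3, h4, h5, h6, h7, h8, h9⟩ := measurable_components hf
  exact measurable_of_components h1 h2 h3 h4 h5 h6 h7 measurable_const (h9.add h8)

lemma measurable_switchCache (R : ArgminRule m) (k T t : ℕ) (d : Fin m → Fin m → ℝ)
    (hf : Measurable f) : Measurable fun a => (f a).switchCache R k T t d := by
  obtain ⟨h1, h2, h3, h4, h5, h6, h7, h8, h9⟩ := measurable_components hf
  have hl : Measurable fun a => fun q => lowerBound m T ((f a).obs q) ((f a).costSum q) :=
    measurable_pi_lambda _ fun q => measurable_lowerBound m T h4.eval h5.eval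
  have hp : Measurable fun a => fun q => ((f a).arrivals q : ℝ) / (t : ℝ) :=
    (measurable_of_countable fun (x : Fin m → ℕ) q => (x q : ℝ) / (t : ℝ)).comp h3
  exact measurable_of_components (measurable_reverseGreedy R k d hp hl) hl h3 h4 h5 h6 h7 h8 h9

lemma measurable_maybeSwitch (R : ArgminRule m) (k T t : ℕ) (d : Fin m → Fin m → ℝ)
    (hf : Measurable f) : Measurable fun a => (f a).maybeSwitch R k T t d := by
  unfold maybeSwitch
  exact Measurable.ite (measurableSet_setOfPred.2 (Measurable.exists (measurable_queryTrigger T hf)))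
    (measurable_switchCache R k T t d (measurable_newQueryStage T hf)) (Measurable.ite
    (measurableSet_setOfPred.2 (measurable_arrivalTrigger T hf))
    (measurable_switchCache R k T t d (measurable_newArrivalStage hf)) hf)

lemma measurable_observes (d : Fin m → Fin m → ℝ) (hf : Measurable f) (q : Fin m) :
    Measurable fun a => (f a).Observes d q := by
  obtain ⟨h1, h2, -⟩ := measurable_components hf
  exact measurable_of_countable_index h1
    (g := fun M a => ((f a).lcb q : WithTop ℝ) < distTo d q M)
    fun _ => measurable_coe_lt_distTo h2.eval _

lemma measurable_update {β : Type*} [MeasurableSpace β] {x : α → Fin m → β}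
    (hx : Measurable x) (q : Fin m) {y : α → β} (hy : Measurable y) :
    Measurable fun a => Function.update (x a) q (y a) := by
  refine measurable_pi_lambda _ fun i => ?_
  by_cases h : i = q
  · subst h; simpa using hy
  · simpa [h] using hx.eval

lemma measurable_serve (d : Fin m → Fin m → ℝ) (hf : Measurable f) {q : α → Fin m}
    (hq : Measurable q) {y : α → ℝ} (hy : Measurable y) :
    Measurable fun a => (f a).serve d (q a) (y a) := by
  refine measurable_of_countable_index hq (g := fun q a => (f a).serve d q (y a)) fun q => ?_
  obtain ⟨h1, h2, h3, h4, h5, h6, h7, h8, h9⟩ := measurable_components hf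
  refine Measurable.ite (measurableSet_setOfPred.2 (measurable_observes d hf q)) ?_ ?_
  · exact measurable_of_components h1 h2
      (measurable_update h3 q (h3.eval.add_const 1)) (measurable_update h4 q (h4.eval.add_const 1))
      (measurable_update h5 q (h5.eval.add hy)) (measurable_update h6 q (h6.eval.add_const 1))
      h7 (h8.add_const 1) h9
  · exact measurable_of_components h1 h2
      (measurable_update h3 q (h3.eval.add_const 1)) h4 h5 h6 h7 (h8.add_const 1) h9

end State

lemma measurable_run {α : Type*} {mα : MeasurableSpace α} (R : ArgminRule m) (k T : ℕ)
    (d : Fin m → Fin m → ℝ) {query : ℕ → α → Fin m} {cost : ℕ → α → Fin m → ℝ} (t : ℕ)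
    (hq : ∀ i ≤ t, Measurable (query i)) (hc : ∀ i ≤ t, Measurable (cost i)) :
    Measurable fun a => run R k T d (fun i => query i a) (fun i => cost i a) t := by
  induction t with
  | zero => exact measurable_const
  | succ t ih =>
    have h := ih (fun i hi => hq i (by omega)) (fun i hi => hc i (by omega))
    exact State.measurable_serve d (State.measurable_maybeSwitch R k T (t + 1) d h)
      (hq _ le_rfl) (measurable_of_countable_index (hq _ le_rfl)
        (g := fun q a => cost (t + 1) a q) fun q => (hc _ le_rfl).eval)

lemma measurable_midState {α : Type*} {mα : MeasurableSpace α} (R : ArgminRule m) (k T : ℕ)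
    (d : Fin m → Fin m → ℝ) {query : ℕ → α → Fin m} {cost : ℕ → α → Fin m → ℝ} (t : ℕ)
    (hq : ∀ i ≤ t, Measurable (query i)) (hc : ∀ i ≤ t, Measurable (cost i)) :
    Measurable fun a => midState R k T d (fun i => query i a) (fun i => cost i a) t :=
  State.measurable_maybeSwitch R k T (t + 1) d (measurable_run R k T d t hq hc)

/-! ### Independence of the past -/

section Past

variable {Ω : Type*} {query : ℕ → Ω → Fin m} {cost : ℕ → Ω → Fin m → ℝ}

/-- The σ-algebra of the rounds up to `t`. -/
abbrev pastSigma (query : ℕ → Ω → Fin m) (cost : ℕ → Ω → Fin m → ℝ) (t : ℕ) : MeasurableSpace Ω :=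
  ⨆ i ∈ Set.Iic t, MeasurableSpace.comap (fun ω => (query i ω, cost i ω)) inferInstance

lemma measurable_pair_pastSigma {i t : ℕ} (h : i ≤ t) :
    Measurable[pastSigma query cost t] fun ω => (query i ω, cost i ω) :=
  measurable_iff_comap_le.2 (le_iSup₂_of_le (f := fun i (_ : i ∈ Set.Iic t) =>
    MeasurableSpace.comap (fun ω => (query i ω, cost i ω)) inferInstance) i h le_rfl)

lemma measurable_midState_pastSigma (R : ArgminRule m) (k T : ℕ) (d : Fin m → Fin m → ℝ) (t : ℕ) :
    Measurable[pastSigma query cost t]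
      fun ω => midState R k T d (fun i => query i ω) (fun i => cost i ω) t :=
  measurable_midState R k T d t (fun _ hi => (measurable_pair_pastSigma hi).fst)
    (fun _ hi => (measurable_pair_pastSigma hi).snd)

variable [MeasurableSpace Ω] {μ : Measure Ω} {p c : Fin m → ℝ}

lemma IsEnvironment.indepFun_past (hE : IsEnvironment μ p c query cost) {t : ℕ} {β γ : Type*}
    [mβ : MeasurableSpace β] [mγ : MeasurableSpace γ] {f : Ω → β} {g : Fin m × (Fin m → ℝ) → γ}
    (hf : Measurable[pastSigma query cost t] f) (hg : Measurable g) :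
    IndepFun f (fun ω => g (query (t + 1) ω, cost (t + 1) ω)) μ := by
  have hi := hE.indep_rounds
  rw [iIndepFun_iff_iIndep] at hi
  have h := indep_iSup_of_disjoint
    (fun i => measurable_iff_comap_le.1 ((hE.measurable_query i).prodMk (hE.measurable_cost i))) hi
    (S := Set.Iic t) (T := {t + 1}) (by simp)
  rw [IndepFun_iff_Indep]
  refine indep_of_indep_of_le_left (indep_of_indep_of_le_right h ?_) (measurable_iff_comap_le.1 hf)
  simp only [Set.mem_singleton_iff, iSup_iSup_eq_left]
  exact measurable_iff_comap_le.1 (hg.comp (comap_measurable _))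

lemma IsEnvironment.measurable_run (hE : IsEnvironment μ p c query cost) (R : ArgminRule m)
    (k T : ℕ) (d : Fin m → Fin m → ℝ) (t : ℕ) :
    Measurable fun ω => run R k T d (fun i => query i ω) (fun i => cost i ω) t :=
  SemanticCaching.measurable_run R k T d t (fun i _ => hE.measurable_query i)
    (fun i _ => hE.measurable_cost i)

lemma IsEnvironment.measurable_midState (hE : IsEnvironment μ p c query cost) (R : ArgminRule m)
    (k T : ℕ) (d : Fin m → Fin m → ℝ) (t : ℕ) :
    Measurable fun ω => midState R k T d (fun i => query i ω) (fun i => cost i ω) t :=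
  SemanticCaching.measurable_midState R k T d t (fun i _ => hE.measurable_query i)
    (fun i _ => hE.measurable_cost i)

end Past

/-! ### Concentration of the observed costs -/

section Concentration

variable {Ω : Type*} [MeasurableSpace Ω] {μ : Measure Ω}
  {p c : Fin m → ℝ} {query : ℕ → Ω → Fin m} {cost : ℕ → Ω → Fin m → ℝ}

lemma IsEnvironment.lintegral_exp_noise_le_one (hE : IsEnvironment μ p c query cost) (t : ℕ)
    (q : Fin m) (x : ℝ) :
    ∫⁻ ω, ENNReal.ofReal (Real.exp (x * (cost t ω q - c q) - x ^ 2 / 8)) ∂μ ≤ 1 := by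
  have hn := hE.noise t q
  have h1 : ∀ ω, Real.exp (x * (cost t ω q - c q) - x ^ 2 / 8) =
      Real.exp (x * (cost t ω q - c q)) * Real.exp (-(x ^ 2 / 8)) := fun ω => by
    rw [← Real.exp_add]; ring_nf
  rw [← ofReal_integral_eq_lintegral_ofReal, ← ENNReal.ofReal_one]
  · refine ENNReal.ofReal_le_ofReal ?_
    simp only [h1]
    rw [integral_mul_const]
    have h2 := hn.mgf_le x
    rw [mgf] at h2
    refine (mul_le_mul_of_nonneg_right h2 (Real.exp_pos _).le).trans ?_
    rw [← Real.exp_add, Real.exp_le_one_iff]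
    push_cast
    linarith
  · simp only [h1]
    exact (hn.integrable_exp_mul x).mul_const _
  · exact Filter.Eventually.of_forall fun ω => (Real.exp_pos _).le

variable [IsProbabilityMeasure μ]

lemma IsEnvironment.lintegral_exp_observation_le_one (hE : IsEnvironment μ p c query cost) (t : ℕ)
    (q : Fin m) (x : ℝ) :
    ∫⁻ ω, (if query t ω = q then
      ENNReal.ofReal (Real.exp (x * (cost t ω q - c q) - x ^ 2 / 8)) else 1) ∂μ ≤ 1 := by
  set H : Ω → ENNReal := fun ω => ENNReal.ofReal (Real.exp (x * (cost t ω q - c q) - x ^ 2 / 8))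
  set φ : Fin m → ENNReal := fun u => if u = q then 1 else 0
  set φ' : Fin m → ENNReal := fun u => if u = q then 0 else 1
  have hφ : Measurable φ := measurable_of_countable _
  have hφ' : Measurable φ' := measurable_of_countable _
  have hψ : Measurable fun y : Fin m → ℝ =>
      ENNReal.ofReal (Real.exp (x * (y q - c q) - x ^ 2 / 8)) := by fun_prop
  have hH : Measurable H := hψ.comp (hE.measurable_cost t)
  have hφm : Measurable fun ω => φ (query t ω) := hφ.comp (hE.measurable_query t)
  have hφm' : Measurable fun ω => φ' (query t ω) := hφ'.comp (hE.measurable_query t)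
  have h1 : ∀ ω, (if query t ω = q then H ω else 1) = φ' (query t ω) + φ (query t ω) * H ω :=
    fun ω => by simp only [φ, φ']; split_ifs <;> simp
  have h2 : IndepFun (fun ω => φ (query t ω)) H μ := (hE.indep_query_cost t).comp hφ hψ
  calc _ = ∫⁻ ω, (φ' (query t ω) + φ (query t ω) * H ω) ∂μ := by simp only [← h1]; rfl
    _ = ∫⁻ ω, φ' (query t ω) ∂μ + (∫⁻ ω, φ (query t ω) ∂μ) * ∫⁻ ω, H ω ∂μ := by
        rw [lintegral_add_left hφm',
          lintegral_mul_eq_lintegral_mul_lintegral_of_indepFun''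
            hφm.aemeasurable hH.aemeasurable h2]
    _ ≤ ∫⁻ ω, φ' (query t ω) ∂μ + (∫⁻ ω, φ (query t ω) ∂μ) * 1 := by
        gcongr; exact hE.lintegral_exp_noise_le_one t q x
    _ = ∫⁻ ω, (φ' (query t ω) + φ (query t ω)) ∂μ := by
        rw [mul_one, lintegral_add_left hφm']
    _ = 1 := by
        have : ∀ ω, φ' (query t ω) + φ (query t ω) = 1 := fun ω => by
          simp only [φ, φ']; split_ifs <;> simp
        simp [this]

/-- The exponential supermartingale of the observed costs of `q`; here `S` is the sum of `n`
observations. -/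
noncomputable def expWeight (x a : ℝ) (n : ℕ) (S : ℝ) : ℝ :=
  Real.exp (x * (S - n * a) - n * (x ^ 2 / 8))

/-- Whether a cost is observed is decided by the past and by the arriving query, both of which are
independent of the cost. -/
lemma IsEnvironment.lintegral_expWeight_le_one (hE : IsEnvironment μ p c query cost)
    (R : ArgminRule m) (k T : ℕ) (d : Fin m → Fin m → ℝ) (q : Fin m) (x : ℝ) (t : ℕ) :
    ∫⁻ ω, ENNReal.ofReal (expWeight x (c q)
      ((run R k T d (fun i => query i ω) (fun i => cost i ω) t).obs q)
      ((run R k T d (fun i => query i ω) (fun i => cost i ω) t).costSum q)) ∂μ ≤ 1 := by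
  classical
  induction t with
  | zero => simp [run, State.init, expWeight]
  | succ t ih =>
    set s : Ω → State m := fun ω => midState R k T d (fun i => query i ω) (fun i => cost i ω) t
      with hs
    set Z : State m → ENNReal := fun s =>
      ENNReal.ofReal (expWeight x (c q) (s.obs q) (s.costSum q)) with hZ
    set G : Fin m × (Fin m → ℝ) → ENNReal := fun y => if y.1 = q then
      ENNReal.ofReal (Real.exp (x * (y.2 q - c q) - x ^ 2 / 8)) else 1 with hG
    set Z₀ : State m → ENNReal := fun s => if s.Observes d q then 0 else Z s
    set Z₁ : State m → ENNReal := fun s => if s.Observes d q then Z s else 0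
    have hZm : Measurable Z := by
      obtain ⟨-, -, -, h4, h5, -⟩ := State.measurable_components (measurable_id (α := State m))
      refine measurable_of_countable_index (h4.eval (a := q)) (g := fun n (s : State m) =>
        ENNReal.ofReal (expWeight x (c q) n (s.costSum q))) fun n => ?_
      have h5' := h5.eval (a := q)
      simp only [id] at h5'
      unfold expWeight
      fun_prop
    have hB : MeasurableSet {s : State m | s.Observes d q} :=
      measurableSet_setOfPred.2 (State.measurable_observes d measurable_id q)
    have hZ₀ : Measurable Z₀ := Measurable.ite hB measurable_const hZm
    have hZ₁ : Measurable Z₁ := Measurable.ite hB hZm measurable_const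
    have hGm : Measurable G := by
      refine Measurable.ite (measurableSet_eq_fun measurable_fst measurable_const) ?_
        measurable_const
      fun_prop
    have hsm := hE.measurable_midState R k T d t
    have hstep : ∀ ω, Z (run R k T d (fun i => query i ω) (fun i => cost i ω) (t + 1)) =
        Z₀ (s ω) + Z₁ (s ω) * G (query (t + 1) ω, cost (t + 1) ω) := fun ω => by
      rw [run_succ]
      change Z ((s ω).serve d _ _) = _
      simp only [hZ, State.serve_obs, State.serve_costSum, Z₀, Z₁, hG]
      by_cases h1 : (s ω).Observes d q
      · by_cases h2 : query (t + 1) ω = q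
        · simp only [h1, h2, and_self, if_true, zero_add]
          unfold expWeight
          rw [← ENNReal.ofReal_mul (Real.exp_pos _).le, ← Real.exp_add]
          congr 2
          push_cast
          ring_nf
        · simp [h1, h2]
      · simp [h1]
    have hZ₀m : Measurable fun ω => Z₀ (s ω) := hZ₀.comp hsm
    have hZ₁m : Measurable fun ω => Z₁ (s ω) := hZ₁.comp hsm
    have hGm' : Measurable fun ω => G (query (t + 1) ω, cost (t + 1) ω) :=
      hGm.comp ((hE.measurable_query _).prodMk (hE.measurable_cost _))
    have hind : IndepFun (fun ω => Z₁ (s ω))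
        (fun ω => G (query (t + 1) ω, cost (t + 1) ω)) μ :=
      hE.indepFun_past (hZ₁.comp (measurable_midState_pastSigma R k T d t)) hGm
    calc _ = ∫⁻ ω, (Z₀ (s ω) + Z₁ (s ω) * G (query (t + 1) ω, cost (t + 1) ω)) ∂μ := by
          simp only [← hstep]; rfl
      _ = ∫⁻ ω, Z₀ (s ω) ∂μ +
          (∫⁻ ω, Z₁ (s ω) ∂μ) * ∫⁻ ω, G (query (t + 1) ω, cost (t + 1) ω) ∂μ := by
          rw [lintegral_add_left hZ₀m,
            lintegral_mul_eq_lintegral_mul_lintegral_of_indepFun'' hZ₁m.aemeasurable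
              hGm'.aemeasurable hind]
      _ ≤ ∫⁻ ω, Z₀ (s ω) ∂μ + (∫⁻ ω, Z₁ (s ω) ∂μ) * 1 := by
          gcongr; exact hE.lintegral_exp_observation_le_one (t + 1) q x
      _ = ∫⁻ ω, (Z₀ (s ω) + Z₁ (s ω)) ∂μ := by
          rw [mul_one, lintegral_add_left hZ₀m]
      _ ≤ 1 := by
          refine le_trans (le_of_eq ?_) ih
          refine lintegral_congr fun ω => ?_
          have : Z₀ (s ω) + Z₁ (s ω) = Z (s ω) := by
            simp only [Z₀, Z₁]; split_ifs <;> simp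
          rw [this]
          simp [hZ, hs, midState]

/-- The logarithm in the confidence width. -/
noncomputable def logTerm (m T : ℕ) : ℝ := Real.log (4 * (m : ℝ) * (T : ℝ) ^ 3)

lemma one_le_four_mul {T : ℕ} (hm : 0 < m) (hT : 3 ≤ T) : (1 : ℝ) < 4 * (m : ℝ) * (T : ℝ) ^ 3 := by
  have h1 : (1 : ℝ) ≤ m := by exact_mod_cast hm
  have h2 : (1 : ℝ) ≤ (T : ℝ) ^ 3 := one_le_pow₀ (by exact_mod_cast (by omega : 1 ≤ T))
  nlinarith

lemma logTerm_pos {T : ℕ} (hm : 0 < m) (hT : 3 ≤ T) : 0 < logTerm m T :=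
  Real.log_pos (one_le_four_mul hm hT)

/-- A deviation of the observed mean by the confidence width, with `sgn = ± 1`. -/
lemma IsEnvironment.measure_cost_deviation_le (hE : IsEnvironment μ p c query cost)
    (R : ArgminRule m) (k : ℕ) {T : ℕ} (hm : 0 < m) (hT : 3 ≤ T) (d : Fin m → Fin m → ℝ)
    (q : Fin m) (t n : ℕ) (hn : 0 < n) (sgn : ℝ) (hsgn : sgn ^ 2 = 1) :
    μ.real {ω | (run R k T d (fun i => query i ω) (fun i => cost i ω) t).obs q = n ∧
      n * Real.sqrt (logTerm m T / (2 * n)) ≤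
      sgn * ((run R k T d (fun i => query i ω) (fun i => cost i ω) t).costSum q - n * c q)} ≤
      (4 * (m : ℝ) * (T : ℝ) ^ 3)⁻¹ := by
  have hL := logTerm_pos hm hT
  have hn' : (0 : ℝ) < n := by exact_mod_cast hn
  set w := Real.sqrt (logTerm m T / (2 * n)) with hw
  have hw0 : 0 ≤ w := Real.sqrt_nonneg _
  have hw2 : 2 * n * w ^ 2 = logTerm m T := by
    rw [hw, Real.sq_sqrt (by positivity)]; field_simp
  set Z : Ω → ENNReal := fun ω => ENNReal.ofReal (expWeight (sgn * (4 * w)) (c q)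
      ((run R k T d (fun i => query i ω) (fun i => cost i ω) t).obs q)
      ((run R k T d (fun i => query i ω) (fun i => cost i ω) t).costSum q)) with hZ
  have hZm : Measurable Z := by
    obtain ⟨-, -, -, h4, h5, -⟩ := State.measurable_components (hE.measurable_run R k T d t)
    refine measurable_of_countable_index (h4.eval (a := q)) (g := fun n ω =>
      ENNReal.ofReal (expWeight (sgn * (4 * w)) (c q) n
        ((run R k T d (fun i => query i ω) (fun i => cost i ω) t).costSum q))) fun n => ?_
    have h5' := h5.eval (a := q)
    unfold expWeight
    fun_prop
  have hexp : Real.exp (logTerm m T) = 4 * (m : ℝ) * (T : ℝ) ^ 3 :=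
    Real.exp_log (zero_lt_one.trans (one_le_four_mul hm hT))
  have hM := mul_meas_ge_le_lintegral (μ := μ) hZm (ENNReal.ofReal (Real.exp (logTerm m T)))
  have h1 := hM.trans (hE.lintegral_expWeight_le_one R k T d q (sgn * (4 * w)) t)
  have h2 : μ {ω | (run R k T d (fun i => query i ω) (fun i => cost i ω) t).obs q = n ∧
      n * w ≤ sgn * ((run R k T d (fun i => query i ω) (fun i => cost i ω) t).costSum q - n * c q)} ≤
      μ {ω | ENNReal.ofReal (Real.exp (logTerm m T)) ≤ Z ω} := by
    refine measure_mono fun ω hω => ?_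
    obtain ⟨hω1, hω2⟩ := hω
    simp only [Set.mem_ofPred_eq, hZ, hω1]
    refine ENNReal.ofReal_le_ofReal (Real.exp_le_exp.2 ?_)
    have h3 : (sgn * (4 * w)) ^ 2 = 16 * w ^ 2 := by rw [mul_pow, hsgn]; ring
    rw [h3, ← hw2]
    nlinarith [mul_le_mul_of_nonneg_left hω2 hw0]
  rw [Measure.real]
  have h3 : ENNReal.ofReal (Real.exp (logTerm m T)) * μ {ω |
      (run R k T d (fun i => query i ω) (fun i => cost i ω) t).obs q = n ∧ n * w ≤
      sgn * ((run R k T d (fun i => query i ω) (fun i => cost i ω) t).costSum q - n * c q)} ≤ 1 :=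
    (mul_le_mul_right h2 _).trans h1
  have h4 := ENNReal.toReal_mono ENNReal.one_ne_top h3
  rw [ENNReal.toReal_mul, ENNReal.toReal_ofReal (Real.exp_pos _).le, hexp, ENNReal.toReal_one] at h4
  rw [← one_div, le_div_iff₀ (zero_lt_one.trans (one_le_four_mul hm hT)), mul_comm]
  exact h4

/-! ### Concentration of the arrivals -/

/-- The sign vector of a set of queries. -/
def signOf (A : Finset (Fin m)) (q : Fin m) : ℝ := if q ∈ A then 1 else -1

lemma IsEnvironment.integral_comp_query (hE : IsEnvironment μ p c query cost) (t : ℕ)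
    (f : Fin m → ℝ) : ∫ ω, f (query t ω) ∂μ = ∑ q, p q * f q := by
  have h1 : ∀ ω, f (query t ω) = ∑ q, (query t ⁻¹' {q}).indicator (fun _ => f q) ω := fun ω => by
    rw [Finset.sum_eq_single (query t ω)]
    · simp
    · intro b _ hb; simp [Ne.symm hb]
    · simp
  have h2 : ∀ q, MeasurableSet (query t ⁻¹' {q}) := fun q =>
    hE.measurable_query t (measurableSet_singleton q)
  simp only [h1]
  rw [integral_finsetSum _ fun q _ => (integrable_const _).indicator (h2 q)]
  refine Finset.sum_congr rfl fun q _ => ?_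
  rw [integral_indicator_const _ (h2 q), smul_eq_mul]
  congr 1
  exact hE.law_query t q

lemma sum_mul_arrivals (R : ArgminRule m) (k T : ℕ) (d : Fin m → Fin m → ℝ) (query : ℕ → Fin m)
    (cost : ℕ → Fin m → ℝ) (f : Fin m → ℝ) (n : ℕ) :
    ∑ q, f q * (run R k T d query cost n).arrivals q = ∑ i ∈ Finset.range n, f (query (i + 1)) := by
  induction n with
  | zero => simp [run, State.init]
  | succ n ih =>
    rw [run_succ, State.serve_arrivals, midState, State.maybeSwitch_arrivals,
      Finset.sum_range_succ, ← ih,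
      ← Finset.add_sum_erase _ _ (Finset.mem_univ (query (n + 1))),
      ← Finset.add_sum_erase _ (fun q => f q * _) (Finset.mem_univ (query (n + 1)))]
    have h : ∀ q ∈ Finset.univ.erase (query (n + 1)),
        f q * ((Function.update (run R k T d query cost n).arrivals (query (n + 1))
          ((run R k T d query cost n).arrivals (query (n + 1)) + 1) q : ℕ) : ℝ) =
        f q * ((run R k T d query cost n).arrivals q : ℝ) := fun q hq => by
      rw [Function.update_of_ne (Finset.ne_of_mem_erase hq)]
    rw [Finset.sum_congr rfl h, Function.update_self]
    push_cast
    ring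

/-- Hoeffding's inequality for the signed sum of the arrival counts. -/
lemma IsEnvironment.measure_arrivals_sign_le (hE : IsEnvironment μ p c query cost)
    (R : ArgminRule m) (k T : ℕ) (d : Fin m → Fin m → ℝ) (A : Finset (Fin m)) (n : ℕ) {ε : ℝ}
    (hε : 0 ≤ ε) :
    μ.real {ω | ε ≤ ∑ q, signOf A q *
      ((run R k T d (fun i => query i ω) (fun i => cost i ω) n).arrivals q - n * p q)} ≤
      Real.exp (-ε ^ 2 / (2 * n)) := by
  set X : ℕ → Ω → ℝ := fun i ω =>
    signOf A (query (i + 1) ω) - ∫ ω', signOf A (query (i + 1) ω') ∂μ with hX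
  have hind : iIndepFun X μ := by
    have h1 := hE.indep_rounds.precomp (g := fun i => i + 1) (fun i j h => by simpa using h)
    exact h1.comp (fun i y => signOf A y.1 - ∫ ω', signOf A (query (i + 1) ω') ∂μ)
      (fun i => ((measurable_of_countable (signOf A)).comp measurable_fst).sub_const _)
  have hsub : ∀ i < n, HasSubgaussianMGF (X i) 1 μ := fun i _ => by
    have h1 := hasSubgaussianMGF_of_mem_Icc (μ := μ) (X := fun ω => signOf A (query (i + 1) ω))
      (a := -1) (b := 1)
      ((measurable_of_countable (signOf A)).comp (hE.measurable_query (i + 1))).aemeasurable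
      (Filter.Eventually.of_forall fun ω => by unfold signOf; split_ifs <;> simp)
    convert h1 using 1
    ext
    simp
    norm_num
  have h2 := HasSubgaussianMGF.measure_sum_range_ge_le_of_iIndepFun hind hsub hε
  have h3 : ∀ ω, ∑ i ∈ Finset.range n, X i ω = ∑ q, signOf A q *
      ((run R k T d (fun i => query i ω) (fun i => cost i ω) n).arrivals q - n * p q) := fun ω => by
    simp only [hX, mul_sub, Finset.sum_sub_distrib, hE.integral_comp_query]
    rw [sum_mul_arrivals, Finset.sum_const, Finset.card_range, nsmul_eq_mul, Finset.mul_sum]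
    congr 1
    exact Finset.sum_congr rfl fun q _ => by ring
  simp only [h3] at h2
  simpa using h2

lemma sum_abs_eq_signOf (x : Fin m → ℝ) :
    ∑ q, |x q| = ∑ q, signOf (Finset.univ.filter fun q => 0 ≤ x q) q * x q := by
  refine Finset.sum_congr rfl fun q _ => ?_
  unfold signOf
  by_cases h : 0 ≤ x q
  · simp [h, abs_of_nonneg h]
  · simp [h, abs_of_neg (not_le.1 h)]

lemma IsEnvironment.measure_arrivals_deviation_le (hE : IsEnvironment μ p c query cost)
    (R : ArgminRule m) (k : ℕ) {T : ℕ} (hm : 0 < m) (hT : 3 ≤ T) (d : Fin m → Fin m → ℝ) (n : ℕ)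
    (hn : 0 < n) :
    μ.real {ω | Real.sqrt (6 * m * Real.log T * n) ≤
      ∑ q, |((run R k T d (fun i => query i ω) (fun i => cost i ω) n).arrivals q : ℝ) - n * p q|} ≤
      ((T : ℝ) ^ 2)⁻¹ := by
  have hn' : (0 : ℝ) < n := by exact_mod_cast hn
  have hm' : (1 : ℝ) ≤ m := by exact_mod_cast hm
  have hT' : (3 : ℝ) ≤ T := by exact_mod_cast hT
  have hlog2 : Real.log 2 ≤ Real.log T := Real.log_le_log (by norm_num) (by linarith)
  have hlog0 : 0 < Real.log 2 := Real.log_pos (by norm_num)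
  set ε := Real.sqrt (6 * m * Real.log T * n) with hε
  have hsub : {ω | ε ≤ ∑ q,
        |((run R k T d (fun i => query i ω) (fun i => cost i ω) n).arrivals q : ℝ) - n * p q|} ⊆
      ⋃ A ∈ (Finset.univ : Finset (Finset (Fin m))), {ω | ε ≤ ∑ q, signOf A q *
      ((run R k T d (fun i => query i ω) (fun i => cost i ω) n).arrivals q - n * p q)} := by
    intro ω hω
    rw [Set.mem_ofPred_eq, sum_abs_eq_signOf] at hω
    exact Set.mem_biUnion (Finset.mem_coe.2 (Finset.mem_univ _)) hω
  refine (measureReal_mono hsub (measure_ne_top _ _)).trans ((measureReal_biUnion_finset_le _ _).trans ?_)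
  refine (Finset.sum_le_sum fun A _ =>
    hE.measure_arrivals_sign_le R k T d A n (Real.sqrt_nonneg _)).trans ?_
  rw [Finset.sum_const, Finset.card_univ, Fintype.card_finset, Fintype.card_fin, nsmul_eq_mul,
    Real.sq_sqrt (by positivity)]
  have e1 : -(6 * m * Real.log T * n) / (2 * (n : ℝ)) = -(3 * m * Real.log T) := by
    field_simp; ring
  have e2 : ((2 ^ m : ℕ) : ℝ) = Real.exp (m * Real.log 2) := by
    rw [Real.exp_nat_mul, Real.exp_log (by norm_num)]; push_cast; rfl
  have e3 : ((T : ℝ) ^ 2)⁻¹ = Real.exp (-(2 * Real.log T)) := by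
    rw [Real.exp_neg]
    congr 1
    have := Real.exp_nat_mul (Real.log T) 2
    rw [Real.exp_log (by linarith)] at this
    exact_mod_cast this.symm
  rw [e1, e2, e3, ← Real.exp_add, Real.exp_le_exp]
  nlinarith [mul_le_mul_of_nonneg_left hlog2 (zero_le_one.trans hm'),
    mul_le_mul_of_nonneg_right hm' (hlog0.le.trans hlog2)]

/-! ### The good event -/

/-- All observed means are within their confidence widths, and the arrival frequencies are close to
the arrival probabilities. -/
def IsGood (R : ArgminRule m) (k T : ℕ) (p c : Fin m → ℝ) (d : Fin m → Fin m → ℝ)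
    (query : ℕ → Fin m) (cost : ℕ → Fin m → ℝ) : Prop :=
  ∀ n < T, (∀ q, 0 < (run R k T d query cost n).obs q →
      |(run R k T d query cost n).costSum q - (run R k T d query cost n).obs q * c q| ≤
        (run R k T d query cost n).obs q *
          Real.sqrt (logTerm m T / (2 * (run R k T d query cost n).obs q))) ∧
    (0 < n → ∑ q, |((run R k T d query cost n).arrivals q : ℝ) - n * p q| ≤
      Real.sqrt (6 * m * Real.log T * n))

lemma IsEnvironment.measure_not_isGood_le (hE : IsEnvironment μ p c query cost)
    (R : ArgminRule m) (k : ℕ) {T : ℕ} (hm : 0 < m) (hT : 3 ≤ T) (d : Fin m → Fin m → ℝ) :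
    μ.real {ω | ¬ IsGood R k T p c d (fun i => query i ω) (fun i => cost i ω)} ≤ 3 / (2 * T) := by
  have hT' : (0 : ℝ) < T := by positivity
  have hm' : (0 : ℝ) < m := by positivity
  set D : ℝ → ℕ → Fin m → ℕ → Set Ω := fun sgn t q n =>
    {ω | (run R k T d (fun i => query i ω) (fun i => cost i ω) t).obs q = n ∧
      n * Real.sqrt (logTerm m T / (2 * n)) ≤
      sgn * ((run R k T d (fun i => query i ω) (fun i => cost i ω) t).costSum q - n * c q)} with hD
  set E : ℕ → Set Ω := fun n => {ω | Real.sqrt (6 * m * Real.log T * n) ≤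
      ∑ q, |((run R k T d (fun i => query i ω) (fun i => cost i ω) n).arrivals q : ℝ) - n * p q|}
    with hEdef
  have hsub : {ω | ¬ IsGood R k T p c d (fun i => query i ω) (fun i => cost i ω)} ⊆
      ⋃ t ∈ Finset.range T, ((⋃ q ∈ (Finset.univ : Finset (Fin m)), ⋃ n ∈ Finset.Ioo 0 T,
        (D 1 t q n ∪ D (-1) t q n)) ∪ if 0 < t then E t else ∅) := by
    intro ω hω
    simp only [IsGood, Set.mem_ofPred_eq, not_forall, not_and_or, not_le] at hω
    obtain ⟨t, ht, h⟩ := hω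
    refine Set.mem_biUnion (Finset.mem_coe.2 (Finset.mem_range.2 ht)) ?_
    rcases h with ⟨q, hq, h⟩ | ⟨h0, h⟩
    · left
      have hle : (run R k T d (fun i => query i ω) (fun i => cost i ω) t).obs q ≤ t :=
        (Finset.single_le_sum (f := fun q =>
          (run R k T d (fun i => query i ω) (fun i => cost i ω) t).obs q)
          (fun _ _ => Nat.zero_le _) (Finset.mem_univ q)).trans (sum_obs_le R k T d _ _ t)
      refine Set.mem_biUnion (Finset.mem_coe.2 (Finset.mem_univ q)) (Set.mem_biUnion
        (Finset.mem_coe.2 (Finset.mem_Ioo.2 ⟨hq, hle.trans_lt ht⟩)) ?_)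
      rcases lt_abs.1 h with h | h
      · exact Or.inl ⟨rfl, by rw [one_mul]; exact h.le⟩
      · exact Or.inr ⟨rfl, by rw [neg_one_mul]; exact h.le⟩
    · right
      rw [if_pos h0]
      exact h.le
  have hDle : ∀ t q, ∀ n ∈ Finset.Ioo 0 T, μ.real (D 1 t q n ∪ D (-1) t q n) ≤
      2 * (4 * (m : ℝ) * (T : ℝ) ^ 3)⁻¹ := fun t q n hn => by
    have hn0 := (Finset.mem_Ioo.1 hn).1
    have h1 := hE.measure_cost_deviation_le R k hm hT d q t n hn0 1 (by norm_num)
    have h2 := hE.measure_cost_deviation_le R k hm hT d q t n hn0 (-1) (by norm_num)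
    refine (measureReal_union_le _ _).trans ?_
    linarith
  have hEle : ∀ t, μ.real (if 0 < t then E t else ∅) ≤ ((T : ℝ) ^ 2)⁻¹ := fun t => by
    split_ifs with h
    · exact hE.measure_arrivals_deviation_le R k hm hT d t h
    · simp
  have hround : ∀ t, μ.real ((⋃ q ∈ (Finset.univ : Finset (Fin m)), ⋃ n ∈ Finset.Ioo 0 T,
        (D 1 t q n ∪ D (-1) t q n)) ∪ if 0 < t then E t else ∅) ≤ 3 / (2 * (T : ℝ) ^ 2) := by
    intro t
    refine (measureReal_union_le _ _).trans ((add_le_add ((measureReal_biUnion_finset_le _ _).trans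
      (Finset.sum_le_sum fun q _ => (measureReal_biUnion_finset_le _ _).trans
        (Finset.sum_le_sum fun n hn => hDle t q n hn))) (hEle t)).trans ?_)
    simp only [Finset.sum_const, Finset.card_univ, Fintype.card_fin, Nat.card_Ioo, nsmul_eq_mul]
    have hcard : ((T - 0 - 1 : ℕ) : ℝ) ≤ T := by exact_mod_cast by omega
    calc _ ≤ (m : ℝ) * (T * (2 * (4 * (m : ℝ) * (T : ℝ) ^ 3)⁻¹)) + ((T : ℝ) ^ 2)⁻¹ := by gcongr
      _ = 3 / (2 * (T : ℝ) ^ 2) := by field_simp; norm_num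
  refine (measureReal_mono hsub (measure_ne_top _ _)).trans ((measureReal_biUnion_finset_le _ _).trans
    ((Finset.sum_le_sum fun t _ => hround t).trans (le_of_eq ?_)))
  rw [Finset.sum_const, Finset.card_range, nsmul_eq_mul]
  field_simp

end Concentration

/-! ### The loss of a round on the good event -/

/-- The expected exploration error of a round whose cache and confidence bounds are those of `s`:
the widths of the confidence intervals of the queries that are sent to the LLM. -/
noncomputable def explorationError (T : ℕ) (p : Fin m → ℝ) (d : Fin m → Fin m → ℝ) (s : State m) :
    ℝ :=
  open Classical in
  ∑ q, p q * if s.Observes d q then stageWidth 1 (2 * logTerm m T) (s.past q) else 0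

/-- A bound for the `ℓ¹`-error of the arrival frequencies used in state `s`. -/
noncomputable def frequencyError (T : ℕ) (s : State m) : ℝ :=
  stageWidth 2 (24 * m * Real.log T) s.pastP

lemma explorationError_nonneg {T : ℕ} {p c : Fin m → ℝ} {d : Fin m → Fin m → ℝ}
    (hM : IsModel p c d) (s : State m) : 0 ≤ explorationError T p d s := by
  refine Finset.sum_nonneg fun q _ => mul_nonneg (hM.p_pos q).le ?_
  split_ifs
  · exact stageWidth_nonneg zero_le_one _ _
  · exact le_rfl

/-- The factor by which the estimation errors enter the regret. -/
noncomputable def errorFactor (p c : Fin m → ℝ) (d : Fin m → Fin m → ℝ) : ℝ :=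
  approxRatio p c d * (2 + curvatureRatio p c d) + 1

lemma one_le_errorFactor {p c : Fin m → ℝ} {d : Fin m → Fin m → ℝ} (hM : IsModel p c d)
    (hκ : curvature p c d < 1) : 1 ≤ errorFactor p c d := by
  have h1 := curvatureRatio_nonneg hM hκ
  have h2 := one_add_half_le_approxRatio hM hκ
  have h3 : 0 ≤ approxRatio p c d * (2 + curvatureRatio p c d) :=
    mul_nonneg (by linarith) (by linarith)
  unfold errorFactor
  linarith

/-- The counts `N` of `n` arrivals are divided by the number `n + 1` of the current round, which adds
at most `1 / n` to the error. -/
lemma sum_frequency_sub_le {p : Fin m → ℝ} (hp : ∀ q, 0 ≤ p q) (hp1 : ∑ q, p q = 1)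
    {N : Fin m → ℕ} {n s : ℕ} (hN : ∑ q, N q = n) (hsn : s ≤ n) {B : ℝ} (hB : 1 ≤ B)
    (hdev : 0 < n → ∑ q, |(N q : ℝ) - n * p q| ≤ Real.sqrt (B * n)) :
    ∑ q, |(N q : ℝ) / ((n + 1 : ℕ) : ℝ) - p q| ≤ stageWidth 2 (4 * B) s := by
  have hN' : ∑ q, (N q : ℝ) = n := by exact_mod_cast hN
  have h2 : ∑ q, |(N q : ℝ) / ((n + 1 : ℕ) : ℝ) - p q| ≤ 2 := by
    calc _ ≤ ∑ q, ((N q : ℝ) / ((n + 1 : ℕ) : ℝ) + p q) := by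
          refine Finset.sum_le_sum fun q _ => (abs_sub _ _).trans ?_
          rw [abs_of_nonneg (by positivity), abs_of_nonneg (hp q)]
      _ = n / ((n + 1 : ℕ) : ℝ) + 1 := by
          rw [Finset.sum_add_distrib, ← Finset.sum_div, hN', hp1]
      _ ≤ 2 := by
          have : (n : ℝ) / ((n + 1 : ℕ) : ℝ) ≤ 1 :=
            div_le_one_of_le₀ (by push_cast; linarith) (by positivity)
          linarith
  unfold stageWidth
  split_ifs with hs
  · exact h2
  refine le_min h2 ?_
  have hs0 : (0 : ℝ) < s := by exact_mod_cast Nat.pos_of_ne_zero hs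
  have hn : 0 < n := by omega
  have hn0 : (1 : ℝ) ≤ n := by exact_mod_cast hn
  have h3 : ∑ q, |(N q : ℝ) / ((n + 1 : ℕ) : ℝ) - p q| ≤ (Real.sqrt (B * n) + 1) / n := by
    have h4 : ∀ q, |(N q : ℝ) / ((n + 1 : ℕ) : ℝ) - p q| ≤
        (|(N q : ℝ) - n * p q| + p q) / ((n + 1 : ℕ) : ℝ) := fun q => by
      have e : (N q : ℝ) / ((n + 1 : ℕ) : ℝ) - p q =
          ((N q - n * p q) - p q) / ((n + 1 : ℕ) : ℝ) := by
        push_cast; field_simp; ring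
      rw [e, abs_div, abs_of_nonneg (show (0 : ℝ) ≤ ((n + 1 : ℕ) : ℝ) by positivity)]
      gcongr
      refine (abs_sub _ _).trans ?_
      rw [abs_of_nonneg (hp q)]
    refine (Finset.sum_le_sum fun q _ => h4 q).trans ?_
    rw [← Finset.sum_div, Finset.sum_add_distrib, hp1]
    have := hdev hn
    gcongr
    omega
  have h5 : 1 ≤ Real.sqrt (B * n) := Real.one_le_sqrt.2 (by nlinarith)
  calc _ ≤ (Real.sqrt (B * n) + 1) / n := h3
    _ ≤ 2 * Real.sqrt (B * n) / n := by gcongr; linarith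
    _ = Real.sqrt (4 * B / n) := by
        rw [eq_comm, Real.sqrt_eq_iff_mul_self_eq (by positivity) (by positivity),
          div_mul_div_comm, mul_mul_mul_comm, Real.mul_self_sqrt (by positivity)]
        field_simp
        norm_num
    _ ≤ Real.sqrt (4 * B / s) := by gcongr

/-- A lower confidence bound is optimistic, and its positive part is off by at most the width of a stage
with `s ≤ N` past observations. -/
lemma lowerBound_le_and_sub_le {T : ℕ} (hL : 0 < logTerm m T) {N s : ℕ} {S a : ℝ}
    (ha0 : 0 < a) (ha1 : a ≤ 1) (hsN : s ≤ N)
    (hdev : 0 < N → |S - N * a| ≤ N * Real.sqrt (logTerm m T / (2 * N))) :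
    lowerBound m T N S ≤ a ∧
      a - max (lowerBound m T N S) 0 ≤ stageWidth 1 (2 * logTerm m T) s := by
  rcases Nat.eq_zero_or_pos N with hN | hN
  · subst hN
    obtain rfl : s = 0 := by omega
    have h : lowerBound m T 0 S = -1 := by simp [lowerBound]
    rw [h]
    refine ⟨by linarith, ?_⟩
    have := le_max_right (-1 : ℝ) 0
    simp only [stageWidth, if_true]
    linarith
  · have hN' : (0 : ℝ) < N := by exact_mod_cast hN
    set w := Real.sqrt (logTerm m T / (2 * N)) with hw
    have h : lowerBound m T N S = S / N - w := by
      simp [lowerBound, hN.ne', hw, logTerm]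
    obtain ⟨h1, h2⟩ := abs_le.1 (hdev hN)
    have h3 : S / N ≤ a + w := by rw [div_le_iff₀ hN']; nlinarith
    have h4 : a - w ≤ S / N := by rw [le_div_iff₀ hN']; nlinarith
    rw [h]
    refine ⟨by linarith, ?_⟩
    have h5 : a - max (S / N - w) 0 ≤ 1 := by
      have := le_max_right (S / N - w) 0
      linarith
    unfold stageWidth
    split_ifs with hs
    · exact h5
    · refine le_min h5 ?_
      have hs0 : (0 : ℝ) < s := by exact_mod_cast Nat.pos_of_ne_zero hs
      have h6 : 2 * w = Real.sqrt (2 * logTerm m T / N) := by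
        rw [eq_comm, Real.sqrt_eq_iff_mul_self_eq (by positivity) (by positivity),
          mul_mul_mul_comm, hw, Real.mul_self_sqrt (by positivity)]
        field_simp
      have h7 : Real.sqrt (2 * logTerm m T / N) ≤ Real.sqrt (2 * logTerm m T / s) := by gcongr
      have := le_max_left (S / N - w) 0
      linarith

theorem IsGood.loss_le {p c : Fin m → ℝ} {d : Fin m → Fin m → ℝ} (hM : IsModel p c d)
    (hκ : curvature p c d < 1) {R : ArgminRule m} {k T : ℕ} (hT : 3 ≤ T) {query : ℕ → Fin m}
    {cost : ℕ → Fin m → ℝ} (hG : IsGood R k T p c d query cost) {t : ℕ} (ht : t < T) :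
    loss p c d (midState R k T d query cost t).cache ≤ approxRatio p c d * optLoss k p c d +
      errorFactor p c d * (frequencyError T (midState R k T d query cost t) +
        explorationError T p d (midState R k T d query cost t)) := by
  classical
  set s := midState R k T d query cost t with hs
  have hβ := curvatureRatio_nonneg hM hκ
  have hα := one_add_half_le_approxRatio hM hκ
  have hopt := optLoss_nonneg hM k
  have hE := explorationError_nonneg (T := T) hM s
  have hC := one_le_errorFactor hM hκ
  have hL := logTerm_pos hM.pos hT
  rcases midState_snapshot R k T d query cost t with ⟨h1, -, -⟩ | ⟨n, hn, hlcb, hcache, hP, hpast⟩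
  · -- before the first switch, the trivial bound `1` for the loss suffices
    have h2 : frequencyError T s = 2 := by simp [frequencyError, stageWidth, hs, h1]
    have h3 := hM.loss_le_one s.cache
    have h4 : 0 ≤ approxRatio p c d * optLoss k p c d := mul_nonneg (by linarith) hopt
    rw [h2]
    nlinarith
  · obtain ⟨hG1, hG2⟩ := hG n (by omega)
    have hT' : (3 : ℝ) ≤ T := by exact_mod_cast hT
    have hlogT : 1 ≤ Real.log T := by
      rw [Real.le_log_iff_exp_le (by linarith)]
      linarith [Real.exp_one_lt_d9]
    have hm1 : (1 : ℝ) ≤ m := by exact_mod_cast hM.pos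
    have hfreq := sum_frequency_sub_le (fun q => (hM.p_pos q).le) hM.p_sum
      (sum_arrivals R k T d query cost n) hP (B := 6 * m * Real.log T)
      (by nlinarith [mul_le_mul hm1 hlogT zero_le_one (by linarith)]) hG2
    rw [show 4 * (6 * (m : ℝ) * Real.log T) = 24 * m * Real.log T by ring] at hfreq
    have hwidth := fun q => lowerBound_le_and_sub_le hL (hM.c_pos q) (hM.c_le_one q) (hpast q)
      (hG1 q)
    have hlcbq : ∀ q, s.lcb q = lowerBound m T ((run R k T d query cost n).obs q)
        ((run R k T d query cost n).costSum q) := fun q => by rw [hs, hlcb]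
    have key := loss_reverseGreedy_le hM hκ R k
      (p' := fun q => ((run R k T d query cost n).arrivals q : ℝ) / ((n + 1 : ℕ) : ℝ))
      (c' := s.lcb)
      (V := fun q => if s.Observes d q then stageWidth 1 (2 * logTerm m T) (s.past q) else 0)
      (fun q => by positivity) (fun q => by rw [hlcbq]; exact (hwidth q).1)
      (fun q => by
        split_ifs
        · exact stageWidth_nonneg zero_le_one _ _
        · exact le_rfl)
      (fun q hq => by
        rw [← hcache] at hq
        have hq' : s.Observes d q := hq
        simp only [if_pos hq']
        rw [hlcbq]
        exact (hwidth q).2) hfreq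
    rw [← hcache] at key
    refine key.trans ?_
    change approxRatio p c d * (optLoss k p c d + frequencyError T s +
      (1 + curvatureRatio p c d) * (frequencyError T s + explorationError T p d s)) +
      (frequencyError T s + explorationError T p d s) ≤ _
    unfold errorFactor
    nlinarith

/-! ### The expected regret -/

section Regret

variable {Ω : Type*} [MeasurableSpace Ω] {μ : Measure Ω} [IsProbabilityMeasure μ]
  {p c : Fin m → ℝ} {d : Fin m → Fin m → ℝ} {query : ℕ → Ω → Fin m} {cost : ℕ → Ω → Fin m → ℝ}

lemma sum_Icc_one_eq_sum_range (f : ℕ → ℝ) (T : ℕ) :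
    ∑ t ∈ Finset.Icc 1 T, f t = ∑ t ∈ Finset.range T, f (t + 1) := by
  induction T with
  | zero => simp
  | succ T ih => rw [Finset.sum_Icc_succ_top (by omega), ih, Finset.sum_range_succ]

lemma IsEnvironment.integrable_randomLoss (hE : IsEnvironment μ p c query cost)
    (R : ArgminRule m) (k T : ℕ) : Integrable (randomLoss R k T p c d query cost) μ := by
  unfold randomLoss totalLoss
  refine integrable_finsetSum _ fun t _ => ?_
  have hcache : ∀ i, Measurable fun ω =>
      cacheAt R k T d (fun t => query t ω) (fun t => cost t ω) i := fun i =>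
    by
      obtain ⟨h1, -⟩ := State.measurable_components (hE.measurable_run R k T d i)
      exact h1
  set f : Finset (Fin m) × Finset (Fin m) → ℝ := fun x => loss p c d x.1 + ∑ q ∈ x.1 \ x.2, c q
  have hf : Measurable fun ω => f (cacheAt R k T d (fun t => query t ω) (fun t => cost t ω) t,
      cacheAt R k T d (fun t => query t ω) (fun t => cost t ω) (t - 1)) :=
    (measurable_of_countable f).comp ((hcache t).prodMk (hcache (t - 1)))
  obtain ⟨b, hb⟩ := (Set.finite_range fun x => ‖f x‖).bddAbove
  have hbound : ∀ x, ‖f x‖ ≤ b := fun x => hb (Set.mem_range_self x)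
  have hInt := Integrable.of_bound (μ := μ) hf.aestronglyMeasurable b
    (Filter.Eventually.of_forall fun ω => hbound _)
  exact hInt

open Classical in
/-- The width for `q` of the current stage if `q` would be observed, and `0` otherwise. -/
noncomputable def observedWidth (T : ℕ) (d : Fin m → Fin m → ℝ) (q : Fin m) (s : State m) : ℝ :=
  if s.Observes d q then stageWidth 1 (2 * logTerm m T) (s.past q) else 0

lemma observedWidth_mem_Icc (T : ℕ) (d : Fin m → Fin m → ℝ) (q : Fin m) (s : State m) :
    observedWidth T d q s ∈ Set.Icc (0 : ℝ) 1 := by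
  unfold observedWidth
  split_ifs
  · exact ⟨stageWidth_nonneg zero_le_one _ _, stageWidth_le _ _⟩
  · simp

lemma measurable_observedWidth (T : ℕ) (d : Fin m → Fin m → ℝ) (q : Fin m) :
    Measurable (observedWidth (m := m) T d q) := by
  obtain ⟨-, -, -, -, -, -, h7, -⟩ := State.measurable_components (measurable_id (α := State m))
  exact Measurable.ite (measurableSet_setOfPred.2 (State.measurable_observes d measurable_id q))
    ((measurable_of_countable fun n => stageWidth 1 (2 * logTerm m T) n).comp (h7.eval (a := q)))
    measurable_const

open Classical in
/-- The arriving query is independent of the past, hence the expected exploration error of a round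
is the expected width of the observation that is made in it. -/
lemma IsEnvironment.integral_observedWidth (hE : IsEnvironment μ p c query cost)
    (R : ArgminRule m) (k T t : ℕ) (q : Fin m) :
    p q * ∫ ω, observedWidth T d q (midState R k T d (fun i => query i ω) (fun i => cost i ω) t) ∂μ =
    ∫ ω, (if query (t + 1) ω = q ∧
      (midState R k T d (fun i => query i ω) (fun i => cost i ω) t).Observes d q then
      stageWidth 1 (2 * logTerm m T)
        ((midState R k T d (fun i => query i ω) (fun i => cost i ω) t).past q) else 0) ∂μ := by
  set φ : Fin m → ℝ := fun u => if u = q then 1 else 0 with hφ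
  have hφm : Measurable fun ω => φ (query (t + 1) ω) :=
    (measurable_of_countable φ).comp (hE.measurable_query (t + 1))
  have hX : Measurable fun ω =>
      observedWidth T d q (midState R k T d (fun i => query i ω) (fun i => cost i ω) t) :=
    (measurable_observedWidth T d q).comp (hE.measurable_midState R k T d t)
  have hind := hE.indepFun_past
    ((measurable_observedWidth T d q).comp (measurable_midState_pastSigma R k T d t))
    ((measurable_of_countable φ).comp measurable_fst)
  have h1 := hind.integral_fun_mul_eq_mul_integral hX.aestronglyMeasurable hφm.aestronglyMeasurable
  have h2 : ∫ ω, φ (query (t + 1) ω) ∂μ = p q := by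
    rw [hE.integral_comp_query]; simp [hφ]
  simp only [Function.comp_def] at h1
  rw [h2, mul_comm] at h1
  rw [← h1]
  refine integral_congr_ae (Filter.Eventually.of_forall fun ω => ?_)
  simp only [hφ, observedWidth]
  split_ifs <;> simp_all

lemma integrable_observedWidth (hE : IsEnvironment μ p c query cost)
    (R : ArgminRule m) (k T t : ℕ) (q : Fin m) :
    Integrable (fun ω =>
      observedWidth T d q (midState R k T d (fun i => query i ω) (fun i => cost i ω) t)) μ :=
  Integrable.of_mem_Icc 0 1
    ((measurable_observedWidth T d q).comp (hE.measurable_midState R k T d t)).aemeasurable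
    (Filter.Eventually.of_forall fun _ => observedWidth_mem_Icc T d q _)

lemma integrable_explorationError (hE : IsEnvironment μ p c query cost)
    (R : ArgminRule m) (k T t : ℕ) :
    Integrable (fun ω => explorationError T p d
      (midState R k T d (fun i => query i ω) (fun i => cost i ω) t)) μ :=
  integrable_finsetSum _ fun q _ => (integrable_observedWidth hE R k T t q).const_mul (p q)

lemma IsEnvironment.sum_integral_explorationError_le (hE : IsEnvironment μ p c query cost)
    (hm : 0 < m) (R : ArgminRule m) (k : ℕ) {T : ℕ} (hT : 3 ≤ T) :
    ∑ t ∈ Finset.range T, ∫ ω, explorationError T p d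
      (midState R k T d (fun i => query i ω) (fun i => cost i ω) t) ∂μ ≤
    m * (stageBound T + 4) * (2 + Real.sqrt (T / m * (2 * logTerm m T))) := by
  classical
  have hInt : ∀ t q, Integrable (fun ω => if query (t + 1) ω = q ∧
      (midState R k T d (fun i => query i ω) (fun i => cost i ω) t).Observes d q then
      stageWidth 1 (2 * logTerm m T)
        ((midState R k T d (fun i => query i ω) (fun i => cost i ω) t).past q) else 0) μ := by
    intro t q
    have h1 := (integrable_observedWidth (d := d) hE R k T t q).indicator
      (hE.measurable_query (t + 1) (measurableSet_singleton q))
    refine h1.congr (Filter.Eventually.of_forall fun ω => ?_)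
    simp only [Set.indicator, observedWidth, Set.mem_preimage, Set.mem_singleton_iff]
    split_ifs <;> simp_all
  have h1 : ∀ t, ∫ ω, explorationError T p d
      (midState R k T d (fun i => query i ω) (fun i => cost i ω) t) ∂μ =
      ∫ ω, ∑ q, (if query (t + 1) ω = q ∧
      (midState R k T d (fun i => query i ω) (fun i => cost i ω) t).Observes d q then
      stageWidth 1 (2 * logTerm m T)
        ((midState R k T d (fun i => query i ω) (fun i => cost i ω) t).past q) else 0) ∂μ := by
    intro t
    rw [integral_finsetSum _ fun q _ => hInt t q]
    change ∫ ω, ∑ q, p q * observedWidth T d q _ ∂μ = _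
    rw [integral_finsetSum _ fun q _ => (integrable_observedWidth hE R k T t q).const_mul (p q)]
    refine Finset.sum_congr rfl fun q _ => ?_
    rw [integral_const_mul, hE.integral_observedWidth]
  simp only [h1]
  rw [← integral_finsetSum _ fun t _ => integrable_finsetSum _ fun q _ => hInt t q]
  refine (integral_mono (integrable_finsetSum _ fun t _ => integrable_finsetSum _ fun q _ =>
    hInt t q) (integrable_const _) fun ω => sum_sum_stageWidth_observed_le R k T d
      (fun i => query i ω) (fun i => cost i ω) hm hT).trans ?_
  simp

/-- The regret, in terms of the bounds for the sums of the errors: the bad event, the arrival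
frequencies, the costs, and the switches. -/
theorem regret_le (hM : IsModel p c d) (hκ : curvature p c d < 1)
    (hE : IsEnvironment μ p c query cost) (R : ArgminRule m) (k : ℕ) {T : ℕ} (hT : 3 ≤ T) :
    regret μ R k T p c d query cost ≤ 3 / 2 + errorFactor p c d *
      (2 * (m * (stageBound T + 3)) +
          (stageBound T + 4) * (4 + Real.sqrt (T * (24 * m * Real.log T))) +
        m * (stageBound T + 4) * (2 + Real.sqrt (T / m * (2 * logTerm m T)))) +
      m * (m * (stageBound T + 3) + (stageBound T + 3)) := by
  have hm := hM.pos
  have hC := one_le_errorFactor hM hκ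
  have hα : 0 ≤ approxRatio p c d := by
    have h1 := one_add_half_le_approxRatio hM hκ
    have h2 := curvatureRatio_nonneg hM hκ
    linarith
  set bad : Set Ω := {ω | ¬ IsGood R k T p c d (fun i => query i ω) (fun i => cost i ω)} with hbad
  set S := toMeasurable μ bad with hS
  have hSm : MeasurableSet S := measurableSet_toMeasurable _ _
  have hSle : μ.real S ≤ 3 / (2 * T) := by
    rw [hS, measureReal_def, measure_toMeasurable]
    exact hE.measure_not_isGood_le R k hm hT d
  set mid : ℕ → Ω → State m := fun t ω =>
    midState R k T d (fun i => query i ω) (fun i => cost i ω) t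
  set F := 2 * (m * (stageBound T + 3)) +
          (stageBound T + 4) * (4 + Real.sqrt (T * (24 * m * Real.log T))) with hF
  set W := (m : ℝ) * (m * (stageBound T + 3) + (stageBound T + 3)) with hW
  set a := approxRatio p c d * optLoss k p c d with ha
  have ha0 : 0 ≤ a := mul_nonneg hα (optLoss_nonneg hM k)
  have hpoint : ∀ ω, randomLoss R k T p c d query cost ω ≤ T * a + (T * S.indicator 1 ω +
      errorFactor p c d * (F + ∑ t ∈ Finset.range T, explorationError T p d (mid t ω)) + W) := by
    intro ω
    have hfreq := sum_stageWidth_arrival_le' R k T d (fun i => query i ω) (fun i => cost i ω) hm hT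
      (B := 24 * m * Real.log T)
    have hsw := sum_switching_le R k T d (fun i => query i ω) (fun i => cost i ω) hM.c_le_one
      (fun q => (hM.c_pos q).le) hm hT
    have hround : ∀ t ∈ Finset.range T, loss p c d (mid t ω).cache ≤ a + S.indicator 1 ω +
        errorFactor p c d * (frequencyError T (mid t ω) + explorationError T p d (mid t ω)) := by
      intro t ht
      have h0 : 0 ≤ errorFactor p c d *
          (frequencyError T (mid t ω) + explorationError T p d (mid t ω)) :=
        mul_nonneg (by linarith) (add_nonneg (stageWidth_nonneg zero_le_two _ _)
          (explorationError_nonneg hM _))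
      by_cases hω : ω ∈ S
      · have h1 := hM.loss_le_one (mid t ω).cache
        rw [Set.indicator_of_mem hω, Pi.one_apply]
        linarith
      · have hgood : IsGood R k T p c d (fun i => query i ω) (fun i => cost i ω) := by
          by_contra h
          exact hω (subset_toMeasurable μ bad h)
        rw [Set.indicator_of_notMem hω, add_zero]
        exact hgood.loss_le hM hκ hT (Finset.mem_range.1 ht)
    unfold randomLoss totalLoss
    rw [sum_Icc_one_eq_sum_range, Finset.sum_add_distrib]
    simp only [Nat.add_sub_cancel, cacheAt_succ] at hsw ⊢
    have hsum := Finset.sum_le_sum hround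
    rw [Finset.sum_add_distrib, Finset.sum_const, Finset.card_range, nsmul_eq_mul,
      ← Finset.mul_sum, Finset.sum_add_distrib] at hsum
    have h2 := mul_le_mul_of_nonneg_left hfreq (show 0 ≤ errorFactor p c d by linarith)
    unfold frequencyError at hsum
    simp only [mid] at hsum ⊢
    linarith
  have hintE : Integrable (fun ω => ∑ t ∈ Finset.range T, explorationError T p d (mid t ω)) μ :=
    integrable_finsetSum _ fun t _ => integrable_explorationError hE R k T t
  have hintS : Integrable (fun ω => (T : ℝ) * S.indicator 1 ω) μ :=
    ((integrable_const (1 : ℝ)).indicator hSm).const_mul _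
  have hint1 : Integrable (fun ω => errorFactor p c d *
      (F + ∑ t ∈ Finset.range T, explorationError T p d (mid t ω))) μ :=
    ((integrable_const F).add hintE).const_mul _
  have hint2 : Integrable (fun ω => (T : ℝ) * S.indicator 1 ω + errorFactor p c d *
      (F + ∑ t ∈ Finset.range T, explorationError T p d (mid t ω))) μ := hintS.add hint1
  have hint3 : Integrable (fun ω => (T : ℝ) * S.indicator 1 ω + errorFactor p c d *
      (F + ∑ t ∈ Finset.range T, explorationError T p d (mid t ω)) + W) μ :=
    hint2.add (integrable_const W)
  have hint4 : Integrable (fun ω => T * a + ((T : ℝ) * S.indicator 1 ω + errorFactor p c d *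
      (F + ∑ t ∈ Finset.range T, explorationError T p d (mid t ω)) + W)) μ :=
    (integrable_const _).add hint3
  have hmono := integral_mono (hE.integrable_randomLoss R k T) hint4 hpoint
  rw [integral_add (integrable_const (T * a)) hint3, integral_add hint2 (integrable_const W),
    integral_add hintS hint1, integral_const_mul (T : ℝ) (fun ω => S.indicator 1 ω),
    integral_const_mul (errorFactor p c d), integral_add (integrable_const _) hintE,
    integral_finsetSum _ fun t _ => integrable_explorationError hE R k T t,
    integral_indicator_one hSm] at hmono
  simp only [integral_const, probReal_univ, one_smul] at hmono
  have hexp := hE.sum_integral_explorationError_le (d := d) hm R k hT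
  have hbadT : (T : ℝ) * μ.real S ≤ 3 / 2 := by
    have hT0 : (0 : ℝ) < T := by positivity
    calc _ ≤ (T : ℝ) * (3 / (2 * T)) := by gcongr
      _ = 3 / 2 := by field_simp
  have h3 := mul_le_mul_of_nonneg_left (add_le_add_right hexp F)
    (show 0 ≤ errorFactor p c d by linarith)
  unfold regret
  rw [Finset.sum_const, Nat.card_Icc, Nat.add_sub_cancel, nsmul_eq_mul, ← ha]
  linarith

end Regret

/-! ### Numerical bounds -/

lemma one_le_mul_log_log {T : ℕ} (hT : 3 ≤ T) : 1 ≤ 13 * Real.log (Real.log T) := by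
  have hT' : (3 : ℝ) ≤ T := by exact_mod_cast hT
  have h1 : (109 / 100 : ℝ) ≤ Real.log T := by
    rw [Real.le_log_iff_exp_le (by linarith)]
    have h2 : Real.exp (109 / 100) = Real.exp 1 * Real.exp (9 / 100) := by
      rw [← Real.exp_add]; norm_num
    have h3 : Real.exp (9 / 100) ≤ 1 / (1 - 9 / 100) := by
      have h4 := Real.add_one_le_exp (-(9 / 100) : ℝ)
      rw [Real.exp_neg] at h4
      rw [le_div_iff₀ (by norm_num), mul_comm, ← le_div_iff₀ (Real.exp_pos _), one_div]
      linarith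
    rw [h2]
    have h5 := Real.exp_one_lt_d9
    have h6 := Real.exp_pos 1
    calc _ ≤ Real.exp 1 * (1 / (1 - 9 / 100)) := by gcongr
      _ ≤ 3 := by norm_num; linarith
      _ ≤ T := hT'
  have h7 := Real.one_sub_inv_le_log_of_pos (show 0 < Real.log T by linarith)
  have h8 : (Real.log T)⁻¹ ≤ (109 / 100 : ℝ)⁻¹ := inv_anti₀ (by norm_num) h1
  norm_num at h8
  linarith

lemma logTerm_le {T : ℕ} (hm : 0 < m) (hT : 3 ≤ T) :
    logTerm m T ≤ 5 * Real.log ((m : ℝ) * T) := by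
  have hm1 : (1 : ℝ) ≤ m := by exact_mod_cast hm
  have hT' : (3 : ℝ) ≤ T := by exact_mod_cast hT
  have h1 : 4 * (m : ℝ) * (T : ℝ) ^ 3 ≤ ((m : ℝ) * T) ^ 5 := by
    have h2 : (4 : ℝ) ≤ (T : ℝ) ^ 2 := by nlinarith
    have h3 : (m : ℝ) ≤ (m : ℝ) ^ 5 := le_self_pow₀ hm1 (by norm_num)
    calc 4 * (m : ℝ) * (T : ℝ) ^ 3 ≤ (T : ℝ) ^ 2 * (m : ℝ) ^ 5 * (T : ℝ) ^ 3 := by gcongr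
      _ = ((m : ℝ) * T) ^ 5 := by ring
  have h4 := Real.log_le_log (zero_lt_one.trans (one_le_four_mul hm hT)) h1
  rw [Real.log_pow] at h4
  unfold logTerm
  exact_mod_cast h4

/-- The bound of `regret_le` has the order `(√(m T log (m T)) + m²) log log T`. -/
lemma regret_bound_le {T : ℕ} (hm : 0 < m) (hT : 3 ≤ T) {b : ℝ} (hb : 1 ≤ b) :
    3 / 2 + b * (2 * (m * (stageBound T + 3)) +
          (stageBound T + 4) * (4 + Real.sqrt (T * (24 * m * Real.log T))) +
        m * (stageBound T + 4) * (2 + Real.sqrt (T / m * (2 * logTerm m T)))) +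
      m * (m * (stageBound T + 3) + (stageBound T + 3)) ≤
    1600 * b * ((Real.sqrt ((m : ℝ) * T * Real.log ((m : ℝ) * T)) + (m : ℝ) ^ 2) *
      Real.log (Real.log T)) := by
  have hm1 : (1 : ℝ) ≤ m := by exact_mod_cast hm
  have hT' : (3 : ℝ) ≤ T := by exact_mod_cast hT
  have hmT : (T : ℝ) ≤ m * T := by nlinarith
  have hlog : Real.log T ≤ Real.log ((m : ℝ) * T) := Real.log_le_log (by linarith) hmT
  have hlog0 : 0 ≤ Real.log ((m : ℝ) * T) := Real.log_nonneg (by linarith)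
  have hll := one_le_mul_log_log hT
  set ll := Real.log (Real.log T) with hlldef
  set X := Real.sqrt ((m : ℝ) * T * Real.log ((m : ℝ) * T)) with hX
  have hX0 : 0 ≤ X := Real.sqrt_nonneg _
  have hmm : (m : ℝ) ≤ (m : ℝ) ^ 2 := by nlinarith
  have h1 : Real.sqrt (T * (24 * m * Real.log T)) ≤ 5 * X := by
    rw [hX, show (5 : ℝ) = Real.sqrt 25 by
      rw [show (25 : ℝ) = 5 ^ 2 by norm_num, Real.sqrt_sq (by norm_num)],
      ← Real.sqrt_mul (by norm_num)]
    apply Real.sqrt_le_sqrt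
    have : (T : ℝ) * (24 * m * Real.log T) = 24 * (m * T * Real.log T) := by ring
    rw [this]
    have h2 : (m : ℝ) * T * Real.log T ≤ m * T * Real.log ((m : ℝ) * T) := by gcongr
    have h3 : 0 ≤ (m : ℝ) * T * Real.log ((m : ℝ) * T) := by positivity
    linarith
  have h2 : m * Real.sqrt (T / m * (2 * logTerm m T)) ≤ 4 * X := by
    rw [hX, show (4 : ℝ) = Real.sqrt 16 by
      rw [show (16 : ℝ) = 4 ^ 2 by norm_num, Real.sqrt_sq (by norm_num)],
      ← Real.sqrt_mul (by norm_num), ← Real.sqrt_sq (show (0 : ℝ) ≤ m by linarith),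
      ← Real.sqrt_mul (by positivity), Real.sqrt_sq (show (0 : ℝ) ≤ m by linarith)]
    apply Real.sqrt_le_sqrt
    have e : (m : ℝ) ^ 2 * (T / m * (2 * logTerm m T)) = 2 * (m * T * logTerm m T) := by
      field_simp
    rw [e]
    have h3 : (m : ℝ) * T * logTerm m T ≤ m * T * (5 * Real.log ((m : ℝ) * T)) := by
      have := logTerm_le hm hT
      gcongr
    have h4 : 0 ≤ (m : ℝ) * T * Real.log ((m : ℝ) * T) := by positivity
    linarith
  set J := stageBound T + 4 with hJdef
  have hJ : J = 6 + 2 * ll := by rw [hJdef, stageBound]; ring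
  have hJ0 : 1 ≤ J := by linarith
  set Y := X + (m : ℝ) ^ 2 with hY
  have hY1 : 1 ≤ Y := by nlinarith
  have e3 : stageBound T + 3 ≤ J := by rw [hJdef]; linarith
  have t1 : 2 * (m * (stageBound T + 3)) + J * (4 + Real.sqrt (T * (24 * m * Real.log T))) +
      m * J * (2 + Real.sqrt (T / m * (2 * logTerm m T))) ≤ J * (17 * Y) := by
    have h3 : (m : ℝ) * (stageBound T + 3) ≤ m * J := by gcongr
    have h4 : 2 * (m : ℝ) + (4 + Real.sqrt (T * (24 * m * Real.log T))) +
        (2 * m + m * Real.sqrt (T / m * (2 * logTerm m T))) ≤ 17 * Y := by nlinarith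
    have h5 := mul_le_mul_of_nonneg_left h4 (show 0 ≤ J by linarith)
    linarith
  have t2 : m * (m * (stageBound T + 3) + (stageBound T + 3)) ≤ J * (2 * Y) := by
    calc (m : ℝ) * (m * (stageBound T + 3) + (stageBound T + 3)) ≤ m * (m * J + J) := by gcongr
      _ = J * (m ^ 2 + m) := by ring
      _ ≤ J * (2 * Y) := by
          apply mul_le_mul_of_nonneg_left _ (by linarith)
          linarith
  have t3 : J ≤ 80 * ll := by linarith
  have t4 : 1 ≤ J * Y := by nlinarith
  have hb0 : 0 ≤ b := by linarith
  have t5 := mul_le_mul_of_nonneg_left t1 hb0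
  have t6 : 3 / 2 + J * (2 * Y) ≤ 3 * b * (J * Y) := by
    have : 3 * (J * Y) ≤ 3 * b * (J * Y) := by nlinarith
    nlinarith
  have t7 : J * Y ≤ 80 * ll * Y := mul_le_mul_of_nonneg_right t3 (by linarith)
  have t8 : 20 * b * (J * Y) ≤ 20 * b * (80 * ll * Y) := by gcongr
  nlinarith

/-- A bound for the approximation ratio also bounds `β`, as `α ≥ 1 + β / 2`. -/
lemma errorFactor_le {p c : Fin m → ℝ} {d : Fin m → Fin m → ℝ} (hM : IsModel p c d)
    (hκ : curvature p c d < 1) {A : ℝ} (hA : approxRatio p c d ≤ A) :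
    errorFactor p c d ≤ A * (2 + 2 * A) + 1 := by
  have h1 := curvatureRatio_nonneg hM hκ
  have h2 := one_add_half_le_approxRatio hM hκ
  unfold errorFactor
  have h3 : curvatureRatio p c d ≤ 2 * A := by linarith
  have h4 : approxRatio p c d * (2 + curvatureRatio p c d) ≤ A * (2 + 2 * A) := by
    apply mul_le_mul hA (by linarith) (by linarith) (by linarith)
  linarith

end SemanticCaching

theorem mainTheorem2 (A : ℝ) :
    ∃ C : ℝ, 0 < C ∧
      ∀ (m k T : ℕ) (p c : Fin m → ℝ) (d : Fin m → Fin m → ℝ)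
        (R : SemanticCaching.ArgminRule m)
        (Ω : Type*) [MeasurableSpace Ω] (μ : Measure Ω) [IsProbabilityMeasure μ]
        (query : ℕ → Ω → Fin m) (cost : ℕ → Ω → Fin m → ℝ),
        SemanticCaching.IsModel p c d →
        SemanticCaching.curvature p c d < 1 →
        SemanticCaching.approxRatio p c d ≤ A →
        SemanticCaching.IsEnvironment μ p c query cost →
        3 ≤ T →
          Integrable (SemanticCaching.randomLoss R k T p c d query cost) μ ∧
          SemanticCaching.regret μ R k T p c d query cost ≤
            C * ((Real.sqrt ((m : ℝ) * T * Real.log ((m : ℝ) * T)) + (m : ℝ) ^ 2) *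
              Real.log (Real.log T)) ∧
          (m ^ 3 ≤ T →
            SemanticCaching.regret μ R k T p c d query cost ≤
              C * (Real.sqrt ((m : ℝ) * T * Real.log ((m : ℝ) * T)) *
                Real.log (Real.log T))) := by
  have hc0 : 0 ≤ |A| * (2 + 2 * |A|) := by positivity
  refine ⟨3200 * (|A| * (2 + 2 * |A|) + 1), by positivity, ?_⟩
  intro m k T p c d R Ω _ μ _ query cost hM hκ hA hE hT
  have hm1 : (1 : ℝ) ≤ m := by exact_mod_cast hM.pos
  have hT' : (3 : ℝ) ≤ T := by exact_mod_cast hT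
  have hll : 0 < Real.log (Real.log T) := by
    linarith [SemanticCaching.one_le_mul_log_log hT]
  have hb := SemanticCaching.errorFactor_le hM hκ (hA.trans (le_abs_self A))
  have hreg := (SemanticCaching.regret_le hM hκ hE R k hT).trans
    (SemanticCaching.regret_bound_le hM.pos hT (SemanticCaching.one_le_errorFactor hM hκ))
  set X := Real.sqrt ((m : ℝ) * T * Real.log ((m : ℝ) * T)) with hX
  have hX0 : 0 ≤ X := Real.sqrt_nonneg _
  set b := |A| * (2 + 2 * |A|) + 1 with hbdef
  have hY0 : 0 ≤ (X + (m : ℝ) ^ 2) * Real.log (Real.log T) := by positivity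
  have hreg' : SemanticCaching.regret μ R k T p c d query cost ≤
      1600 * b * ((X + (m : ℝ) ^ 2) * Real.log (Real.log T)) :=
    hreg.trans (by gcongr)
  have hb0 : 0 ≤ b := by linarith
  refine ⟨hE.integrable_randomLoss R k T, hreg'.trans ?_, fun hmT => hreg'.trans ?_⟩
  · have := mul_nonneg hb0 hY0
    linarith
  · have hmT' : (m : ℝ) ^ 3 ≤ T := by exact_mod_cast hmT
    have hlog1 : 1 ≤ Real.log ((m : ℝ) * T) := by
      rw [Real.le_log_iff_exp_le (by positivity)]
      have := Real.exp_one_lt_d9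
      nlinarith
    have hm2 : (m : ℝ) ^ 2 ≤ X := by
      apply Real.le_sqrt_of_sq_le
      calc ((m : ℝ) ^ 2) ^ 2 = m * (m : ℝ) ^ 3 * 1 := by ring
        _ ≤ m * T * Real.log ((m : ℝ) * T) := by gcongr
    calc 1600 * b * ((X + (m : ℝ) ^ 2) * Real.log (Real.log T))
        ≤ 1600 * b * ((X + X) * Real.log (Real.log T)) := by gcongr
      _ = 3200 * b * (X * Real.log (Real.log T)) := by ring
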